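/- Let $(a_i)_{i\ge1}$ be positive real numbers with $\sum_i a_i<1$, let $m\in\{1,2,\dots\}$ and $1\le p<\infty$. Let $\ell^2$ be the space of square-summable real sequences indexed by $\{1,2,\dots\}$, with standard unit vectors $e_i$, and let $P$ be the probability measure on $\ell^2$ obtained by restricting to $\ell^2$ the product measure $\prod_i N(0,a_i^2)$ on $\mathbb R^{\mathbb N}$. For $\varphi:\ell^2\to\mathbb R$ put $D_{x_i}\varphi(x)=\lim_{t\to0}\frac{\varphi(x+te_i)-\varphi(x)}t$, $D^k_{x_{i_1}\cdots x_{i_k}}=D_{x_{i_1}}\circ\cdots\circ D_{x_{i_k}}$, and $D_{x_i}^*\varphi=-D_{x_i}\varphi+\frac{x_i}{a_i^2}\varphi$. Call $\varphi$ *F-continuous* if $(s_1,\dots,s_l)\mapsto\varphi(x+s_1e_1+\dots+s_le_l)$ is continuous on $\mathbb R^l$ for all $x\in\ell^2$, $l\ge1$. The class of test functions $C^\infty_{\mathcal F}(\ell^2)$ consists of all $\varphi:\ell^2\to\mathbb R$ vanishing outside a bounded set such that $\varphi$ is Borel measurable and F-continuous, all partial derivatives of $\varphi$ of all orders exist everywhere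 and are bounded, Borel measurable and F-continuous, and $\sup_{x}\sum_{i_1,\dots,i_k}a_{i_1}^2\cdots a_{i_k}^2|D^k_{x_{i_1}\cdots x_{i_k}}\varphi(x)|^2<\infty$ for every $k\ge1$. For $f\in L^p(\ell^2,P)$, a function $g\in L^p(\ell^2,P)$ is the weak derivative $D^k_{x_{i_1}\cdots x_{i_k}}f$ if $$\int_{\ell^2}g\,\varphi\,dP=\int_{\ell^2}f\,(D_{x_{i_k}}^*\circ\cdots\circ D_{x_{i_1}}^*)\varphi\,dP\qquad\text{for all }\varphi\in C^\infty_{\mathcal F}(\ell^2).$$ Let $W^{m,p}(\ell^2)$ be the set of all $f\in L^p(\ell^2,P)$ that have all weak derivatives of orders $1,\dots,m$ in $L^p(\ell^2,P)$ and for which $$\|f\|_{W^{m,p}(\ell^2)}=\Big(\int_{\ell^2}|f|^p\,dP+\sum_{k=1}^m\sum_{i_1,\dots,i_k=1}^\infty a_{i_1}^p\cdots a_{i_k}^p\int_{\ell^2}|D^k_{x_{i_1}\cdots x_{i_k}}f|^p\,dP\Big)^{1/p}<\infty.$$ Let $\mathscr C_c^\infty$ be the set of all functions $x\mapsto u(x_1,\dots,x_k)$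 on $\ell^2$ with $k\ge1$ and $u\in C_c^\infty(\mathbb R^k)$. Then $\mathscr C_c^\infty\subset W^{m,p}(\ell^2)$, and for every $f\in W^{m,p}(\ell^2)$ there is a sequence $(\varphi_n)_{n\ge1}$ in $\mathscr C_c^\infty$ with $$\lim_{n\to\infty}\|\varphi_n-f\|_{W^{m,p}(\ell^2)}=0.$$ -/

import Mathlib

open MeasureTheory ProbabilityTheory Filter Topology
open scoped ENNReal NNReal

noncomputable section

namespace GaussSobolev

/-- The Hilbert space `ℓ²` of square-summable real sequences; coordinates are numbered from `0`. -/
abbrev Ell2 : Type := lp (fun _ : ℕ => ℝ) 2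

instance instMeasurableSpaceEll2 : MeasurableSpace Ell2 := borel Ell2

instance instBorelSpaceEll2 : BorelSpace Ell2 := ⟨rfl⟩

/-- The `i`-th standard unit vector of `ℓ²`. -/
def e (i : ℕ) : Ell2 := lp.single 2 i (1 : ℝ)

/-- The product measure `∏ N(0, a i ^ 2)` on the space of all real sequences. -/
def gaussProd (a : ℕ → ℝ) : Measure (ℕ → ℝ) :=
  Measure.infinitePi fun i => gaussianReal 0 (Real.toNNReal (a i ^ 2))

/-- The coordinate map from `ℓ²` to the space of all real sequences. -/
def coords (x : Ell2) : ℕ → ℝ := fun i => x i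

theorem continuous_coords : Continuous coords := continuous_pi fun i => by
  have : LipschitzWith 1 (fun x : Ell2 => x i) := LipschitzWith.of_dist_le_mul fun x y => by
    have := lp.norm_apply_le_norm (p := 2) (by norm_num) (x - y) i
    simpa [dist_eq_norm] using this
  exact this.continuous

theorem injective_coords : Function.Injective coords := fun x y h => by ext i; exact congrFun h i

instance instSeparableSpaceEll2 : TopologicalSpace.SeparableSpace Ell2 := by
  rw [← TopologicalSpace.isSeparable_univ_iff]
  have h : (Submodule.span ℝ (Set.range e)).topologicalClosure = ⊤ := by
    rw [eq_top_iff]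
    intro x _
    have := lp.hasSum_single (p := 2) (by norm_num) x
    refine mem_closure_of_tendsto this (Filter.Eventually.of_forall fun s => ?_)
    refine Submodule.sum_mem _ fun i _ => ?_
    have : lp.single 2 i (x i) = (x i) • e i := by
      rw [e, ← lp.single_smul]; simp
    rw [this]
    exact Submodule.smul_mem _ _ (Submodule.subset_span ⟨i, rfl⟩)
  have h2 := ((Set.countable_range e).isSeparable.span (R := ℝ)).closure
  have h3 : closure (Submodule.span ℝ (Set.range e) : Set Ell2) = Set.univ := by
    have := congrArg (fun S : Submodule ℝ Ell2 => (S : Set Ell2)) h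
    simpa using this
  rwa [h3] at h2

instance instSecondCountableTopologyEll2 : SecondCountableTopology Ell2 := UniformSpace.secondCountable_of_separable _

/-- The coordinate map is a measurable embedding, so the restriction `P` below is a genuine one. -/
theorem measurableEmbedding_coords : MeasurableEmbedding coords := continuous_coords.measurableEmbedding injective_coords

/-- The measure `P` on `ℓ²`: the restriction of the product measure to `ℓ²`. -/
def P (a : ℕ → ℝ) : Measure Ell2 := (gaussProd a).comap coords

theorem range_coords : Set.range coords = {x : ℕ → ℝ | Summable fun i => x i ^ 2} := by
  ext x
  constructor
  · rintro ⟨y, rfl⟩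
    have := lp.memℓp y
    have := (memℓp_gen_iff (p := 2) (by norm_num)).1 this
    simpa [coords] using this
  · intro h
    have : Memℓp x 2 := (memℓp_gen_iff (by norm_num)).2 (by simpa using h)
    exact ⟨⟨x, this⟩, rfl⟩

/-- The product measure is concentrated on `ℓ²`, so `P` is a probability measure. -/
theorem isProbabilityMeasure_P (a : ℕ → ℝ) (ha : ∀ i, 0 < a i) (hs : Summable a) (h1 : ∑' i, a i < 1) :
    IsProbabilityMeasure (P a) := by
  constructor
  have hp : IsProbabilityMeasure (gaussProd a) := by unfold gaussProd; infer_instance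
  rw [P, measurableEmbedding_coords.comap_apply, Set.image_univ]
  have key : ∫⁻ x, ∑' i, ENNReal.ofReal (x i ^ 2) ∂(gaussProd a) < ∞ := by
    rw [lintegral_tsum (fun i => (by fun_prop : Measurable fun x : ℕ → ℝ => ENNReal.ofReal (x i ^ 2)).aemeasurable)]
    have : ∀ i, ∫⁻ x, ENNReal.ofReal (x i ^ 2) ∂(gaussProd a) = ENNReal.ofReal (a i ^ 2) := by
      intro i
      have hm := measurePreserving_eval_infinitePi (fun i => gaussianReal 0 (Real.toNNReal (a i ^ 2))) i
      have := hm.lintegral_comp (f := fun y => ENNReal.ofReal (y ^ 2)) (by fun_prop)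
      unfold gaussProd
      simp only [Function.eval] at this
      rw [this]
      rw [← ofReal_integral_eq_lintegral_ofReal]
      · congr 1
        have := variance_id_gaussianReal (μ := 0) (v := Real.toNNReal (a i ^ 2))
        rw [variance_eq_integral (by fun_prop)] at this
        simpa [integral_id_gaussianReal, sq_nonneg] using this
      · exact (memLp_id_gaussianReal 2).integrable_sq
      · exact Filter.Eventually.of_forall fun x => sq_nonneg x
    simp_rw [this]
    rw [← ENNReal.ofReal_tsum_of_nonneg (fun i => sq_nonneg _)]
    · exact ENNReal.ofReal_lt_top
    · refine Summable.of_nonneg_of_le (fun i => sq_nonneg _) (fun i => ?_) hs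
      have : a i ≤ 1 := (hs.le_tsum i (fun j _ => (ha j).le)).trans h1.le
      nlinarith [ha i]
  have hae := ae_lt_top (by fun_prop) key.ne
  rw [range_coords]
  refine prob_compl_eq_zero_iff₀ ?_ |>.1 ?_
  · rw [← range_coords]; exact measurableEmbedding_coords.measurableSet_range.nullMeasurableSet
  · change ∀ᵐ x ∂_, _
    filter_upwards [hae] with x hx
    have := ENNReal.summable_toReal hx.ne
    simpa [sq_nonneg] using this

/-- `E` is uniformly included in `V`: `E` is bounded and has a uniform neighbourhood inside `V`. -/
def UniformlyIncluded (E V : Set Ell2) : Prop :=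
  ∃ r R : ℝ, 0 < r ∧ 0 < R ∧ (⋃ x ∈ E, Metric.ball x r) ⊆ V ∧ E ⊆ Metric.ball 0 R

/-- Continuity along the spans of the first `l` unit vectors, for all `l ≥ 1`. -/
def FContinuous (f : Ell2 → ℝ) : Prop :=
  ∀ (x : Ell2) (l : ℕ), 1 ≤ l →
    Continuous fun s : Fin l → ℝ => f (x + ∑ j : Fin l, s j • e j)

/-- The partial derivative `D_{x_i} f` exists at `x`. -/
def HasPartialAt (i : ℕ) (f : Ell2 → ℝ) (x : Ell2) : Prop :=
  DifferentiableAt ℝ (fun t : ℝ => f (x + t • e i)) 0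

/-- The (classical) partial derivative `D_{x_i} f`. -/
def pd (i : ℕ) (f : Ell2 → ℝ) (x : Ell2) : ℝ :=
  deriv (fun t : ℝ => f (x + t • e i)) 0

/-- The iterated partial derivative `D_{x_{i_1}} ∘ ⋯ ∘ D_{x_{i_k}}` applied to `f`, for the list
`[i_1, …, i_k]` of indices. -/
def pds (I : List ℕ) (f : Ell2 → ℝ) : Ell2 → ℝ := I.foldr pd f

/-- The class `C_F^∞(ℓ²)`: `f` and all its partial derivatives exist, are Borel measurable and
F-continuous, and the partial derivatives (of order at least one) are bounded. -/
structure IsCFSmooth (f : Ell2 → ℝ) : Prop where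
  exists_pd : ∀ (I : List ℕ) (i : ℕ) (x : Ell2), HasPartialAt i (pds I f) x
  measurable : ∀ I : List ℕ, Measurable (pds I f)
  fContinuous : ∀ I : List ℕ, FContinuous (pds I f)
  bounded : ∀ I : List ℕ, I ≠ [] → ∃ C : ℝ, ∀ x, |pds I f x| ≤ C

/-- The class of test functions `C_𝓕^∞(ℓ²)`. -/
structure IsTest (a : ℕ → ℝ) (φ : Ell2 → ℝ) : Prop where
  smooth : IsCFSmooth φ
  sup_lt_top : ∀ k : ℕ, 1 ≤ k →
    (⨆ x : Ell2, ∑' I : Fin k → ℕ,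
      ENNReal.ofReal ((∏ j, a (I j) ^ 2) * |pds (List.ofFn I) φ x| ^ 2)) < ∞
  support : UniformlyIncluded (φ ⁻¹' {0}ᶜ) Set.univ

/-- The operator `D_{x_i}^* φ = - D_{x_i} φ + (x_i / a_i ^ 2) φ`. -/
def pdStar (a : ℕ → ℝ) (i : ℕ) (φ : Ell2 → ℝ) (x : Ell2) : ℝ :=
  - pd i φ x + x i / a i ^ 2 * φ x

/-- `D_{x_{i_k}}^* ∘ ⋯ ∘ D_{x_{i_1}}^*` applied to `φ`, for the list `[i_1, …, i_k]` of indices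
(`D_{x_{i_1}}^*` acts first). -/
def pdStars (a : ℕ → ℝ) (I : List ℕ) (φ : Ell2 → ℝ) : Ell2 → ℝ :=
  I.foldl (fun ψ i => pdStar a i ψ) φ

/-- `g ∈ L^p(ℓ², P)` is the weak derivative `D_{x_{i_1} ⋯ x_{i_k}}^k f`. -/
def HasWeakDeriv (a : ℕ → ℝ) (p : ℝ) (I : List ℕ) (f g : Ell2 → ℝ) : Prop :=
  MemLp g (ENNReal.ofReal p) (P a) ∧
    ∀ φ : Ell2 → ℝ, IsTest a φ → ∫ x, g x * φ x ∂(P a) = ∫ x, f x * pdStars a I φ x ∂(P a)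

open Classical in
/-- The weak derivative `D_{x_{i_1} ⋯ x_{i_k}}^k f`, as an element of `L^p(ℓ², P)` (determined
up to almost everywhere equality); `0` if it does not exist in `L^p(ℓ², P)`. -/
def weakDeriv (a : ℕ → ℝ) (p : ℝ) (I : List ℕ) (f : Ell2 → ℝ) : Ell2 → ℝ :=
  if h : ∃ g, HasWeakDeriv a p I f g then h.choose else 0

/-- `∑_{k=1}^m ∑_{i_1,…,i_k} a_{i_1}^p ⋯ a_{i_k}^p ∫ |D_{x_{i_1} ⋯ x_{i_k}}^k f|^p dP`. -/
def derivEnergy (a : ℕ → ℝ) (m : ℕ) (p : ℝ) (f : Ell2 → ℝ) : ℝ≥0∞ :=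
  ∑ k ∈ Finset.Icc 1 m, ∑' I : Fin k → ℕ,
    (∏ j, ENNReal.ofReal (a (I j) ^ p)) * ∫⁻ x, ‖weakDeriv a p (List.ofFn I) f x‖ₑ ^ p ∂(P a)

/-- Membership in the Sobolev space `W^{m,p}(ℓ²)`. -/
structure MemW (a : ℕ → ℝ) (m : ℕ) (p : ℝ) (f : Ell2 → ℝ) : Prop where
  memLp : MemLp f (ENNReal.ofReal p) (P a)
  exists_weakDeriv : ∀ k ∈ Finset.Icc 1 m, ∀ I : Fin k → ℕ,
    ∃ g, HasWeakDeriv a p (List.ofFn I) f g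
  energy_lt_top : derivEnergy a m p f < ∞

/-- The norm of `W^{m,p}(ℓ²)`, with values in `[0, ∞]`; it is finite on `W^{m,p}(ℓ²)`. -/
def normW (a : ℕ → ℝ) (m : ℕ) (p : ℝ) (f : Ell2 → ℝ) : ℝ≥0∞ :=
  ((∫⁻ x, ‖f x‖ₑ ^ p ∂(P a)) + derivEnergy a m p f) ^ (1 / p)

/-- The class `𝒞_c^∞` of smooth cylinder functions: functions `x ↦ u (x_1, …, x_k)` with `k ≥ 1`
and `u : ℝ^k → ℝ` smooth with compact support. -/
def IsCylinder (φ : Ell2 → ℝ) : Prop :=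
  ∃ (k : ℕ) (u : (Fin k → ℝ) → ℝ), 1 ≤ k ∧ ContDiff ℝ ((⊤ : ℕ∞) : WithTop ℕ∞) u ∧
    HasCompactSupport u ∧ ∀ x : Ell2, φ x = u fun j => x j

end GaussSobolev

end

noncomputable section

namespace GaussSobolev

local notation "C∞" => ((⊤ : ℕ∞) : WithTop ℕ∞)

/-! ### Smooth functions on `ℓ²` with bounded derivatives -/

/-! Let `g I` be the weak derivatives of `f`. Integrating out all coordinates but the first `n`
turns `g I` into a function `avg a n (g I)` of `n` variables, the conditional expectation given
those coordinates. It contracts `L^p` by Jensen and tends to `g I` in `L^p` as `n → ∞`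
(`tendsto_eLpNorm_avg_sub`). Averaging commutes with weak differentiation in the directions `i < n`
(`integral_avg_weakDeriv`), while the derivatives of a function of the first `n` variables in the
other directions vanish; so the averages are the derivatives of one Sobolev function on `ℝⁿ`. The
norm involves infinitely many multi-indices, but the contraction dominates each error by twice the
norm of `g I`, and dominated convergence for series (`tendsto_jetEnergy_avgJet_sub`) reduces the
problem to a fixed `n`.

On `ℝⁿ` the argument is classical. The Gaussian density is smooth and positive, so Gaussian weak
derivatives are Lebesgue weak derivatives (`isJet_avgJet`); truncation by a wide bump followed by
mollification gives a function in `C_c^∞` (`exists_smooth_approx_jet`). Its error is uniform over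
the multi-indices of order at most `m`, and uniform errors are summable against the weights because
`∑ a_i^p < ∞`.

Two points are genuinely infinite-dimensional. A cylinder function need not have bounded support in
`ℓ²`, hence need not be a test function; it is multiplied by `cut N`, a smooth function of the norm
whose first partial derivatives are of size `1 / (N + 1)`, and dominated convergence removes the
factor. And the norm is built from chosen weak derivatives, so uniqueness is needed
(`HasWeakDeriv.unique`); it too follows from averaging. With Gaussian integration by parts
(`BddSupp.integral_pds_mul`) it identifies the weak derivatives of a cylinder function with its
bounded classical ones, which gives the inclusion. -/

theorem norm_e (i : ℕ) : ‖e i‖ = 1 := by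
  rw [e, lp.norm_single (by norm_num)]; simp

theorem e_apply (i j : ℕ) : (e i) j = if j = i then 1 else 0 := by
  rw [e, lp.single_apply]; simp [Pi.single_apply]

theorem coe_add (x y : Ell2) (i : ℕ) : (x + y) i = x i + y i := rfl

theorem coe_sub (x y : Ell2) (i : ℕ) : (x - y) i = x i - y i := rfl

theorem coe_smul (c : ℝ) (x : Ell2) (i : ℕ) : (c • x) i = c * x i := rfl

theorem abs_coord_le (x : Ell2) (i : ℕ) : |x i| ≤ ‖x‖ :=
  lp.norm_apply_le_norm (p := 2) (by norm_num) x i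

theorem measurable_coord (i : ℕ) : Measurable fun x : Ell2 => x i :=
  ((continuous_apply i).comp continuous_coords).measurable

/-- Smooth functions all of whose Fréchet derivatives are bounded. -/
structure BSmooth (f : Ell2 → ℝ) : Prop where
  contDiff : ContDiff ℝ C∞ f
  bounded : ∀ k : ℕ, ∃ C : ℝ, ∀ x, ‖iteratedFDeriv ℝ k f x‖ ≤ C

theorem hasDerivAt_line {f : Ell2 → ℝ} (hf : Differentiable ℝ f) (i : ℕ) (x : Ell2) :
    HasDerivAt (fun t : ℝ => f (x + t • e i)) (fderiv ℝ f x (e i)) 0 := by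
  have h1 : HasDerivAt (fun t : ℝ => x + t • e i) (e i) 0 := by
    simpa using ((hasDerivAt_id (0 : ℝ)).smul_const (e i)).const_add x
  have h2 : HasFDerivAt f (fderiv ℝ f x) (x + (0 : ℝ) • e i) := by
    simpa using (hf x).hasFDerivAt
  exact h2.comp_hasDerivAt (0 : ℝ) h1

theorem pd_eq_fderiv {f : Ell2 → ℝ} (hf : Differentiable ℝ f) (i : ℕ) :
    pd i f = fun x => fderiv ℝ f x (e i) :=
  funext fun x => (hasDerivAt_line hf i x).deriv

theorem HasPartialAt.hasDerivAt {i : ℕ} {f : Ell2 → ℝ} {x : Ell2} (h : HasPartialAt i f x) :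
    HasDerivAt (fun t : ℝ => f (x + t • e i)) (pd i f x) 0 :=
  DifferentiableAt.hasDerivAt h

namespace BSmooth

variable {f g : Ell2 → ℝ}

theorem differentiable (hf : BSmooth f) : Differentiable ℝ f :=
  hf.contDiff.differentiable (by simp)

theorem hasPartialAt (hf : BSmooth f) (i : ℕ) (x : Ell2) : HasPartialAt i f x :=
  (hasDerivAt_line hf.differentiable i x).differentiableAt

theorem continuous (hf : BSmooth f) : Continuous f := hf.contDiff.continuous

theorem exists_bound (hf : BSmooth f) : ∃ C : ℝ, 0 ≤ C ∧ ∀ x, |f x| ≤ C := by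
  obtain ⟨C, hC⟩ := hf.bounded 0
  have h : ∀ x, |f x| ≤ C := fun x => by simpa using hC x
  exact ⟨C, (abs_nonneg _).trans (h 0), h⟩

theorem pd (hf : BSmooth f) (i : ℕ) : BSmooth (pd i f) := by
  rw [pd_eq_fderiv hf.differentiable]
  have h1 : ContDiff ℝ C∞ (fderiv ℝ f) := hf.contDiff.fderiv_right (by simp)
  refine ⟨h1.clm_apply contDiff_const, fun k => ?_⟩
  obtain ⟨C, hC⟩ := hf.bounded (k + 1)
  refine ⟨C, fun x => ?_⟩
  refine (norm_iteratedFDeriv_clm_apply_const (N := C∞) h1.contDiffAt ?_).trans ?_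
  · exact_mod_cast le_top
  · rw [norm_e, one_mul, norm_iteratedFDeriv_fderiv]
    exact hC x

theorem pds (hf : BSmooth f) (I : List ℕ) : BSmooth (pds I f) := by
  induction I with
  | nil => exact hf
  | cons i I ih => exact ih.pd i

theorem mul (hf : BSmooth f) (hg : BSmooth g) : BSmooth fun x => f x * g x := by
  refine ⟨hf.contDiff.mul hg.contDiff, fun k => ?_⟩
  choose C hC using hf.bounded
  choose D hD using hg.bounded
  refine ⟨_, fun x => (norm_iteratedFDeriv_mul_le (N := C∞) hf.contDiff hg.contDiff x
    (by exact_mod_cast le_top)).trans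
    (Finset.sum_le_sum fun i _ => (mul_le_mul (mul_le_mul_of_nonneg_left (hC i x) (by positivity))
      (hD (k - i) x) (norm_nonneg _)
      (mul_nonneg (by positivity) ((norm_nonneg _).trans (hC i x)))))⟩

theorem const_mul (hf : BSmooth f) (c : ℝ) : BSmooth fun x => c * f x := by
  refine ⟨contDiff_const.mul hf.contDiff, fun k => ?_⟩
  obtain ⟨C, hC⟩ := hf.bounded k
  refine ⟨|c| * C, fun x => ?_⟩
  have : iteratedFDeriv ℝ k (fun x => c * f x) x = c • iteratedFDeriv ℝ k f x :=
    iteratedFDeriv_const_smul_apply (a := c) (hf.contDiff.contDiffAt.of_le (by exact_mod_cast le_top))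
  rw [this, norm_smul, Real.norm_eq_abs]
  exact mul_le_mul_of_nonneg_left (hC x) (abs_nonneg _)

theorem add (hf : BSmooth f) (hg : BSmooth g) : BSmooth fun x => f x + g x := by
  refine ⟨hf.contDiff.add hg.contDiff, fun k => ?_⟩
  obtain ⟨C, hC⟩ := hf.bounded k
  obtain ⟨D, hD⟩ := hg.bounded k
  refine ⟨C + D, fun x => ?_⟩
  have : iteratedFDeriv ℝ k (fun x => f x + g x) x
      = iteratedFDeriv ℝ k f x + iteratedFDeriv ℝ k g x :=
    iteratedFDeriv_add_apply (hf.contDiff.contDiffAt.of_le (by exact_mod_cast le_top))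
      (hg.contDiff.contDiffAt.of_le (by exact_mod_cast le_top))
  rw [this]
  exact (norm_add_le _ _).trans (add_le_add (hC x) (hD x))

theorem comp_clm {F : Type*} [NormedAddCommGroup F] [NormedSpace ℝ F] {u : F → ℝ}
    (hu : ContDiff ℝ C∞ u) (hb : ∀ k : ℕ, ∃ C : ℝ, ∀ x, ‖iteratedFDeriv ℝ k u x‖ ≤ C)
    (L : Ell2 →L[ℝ] F) : BSmooth fun x => u (L x) := by
  refine ⟨hu.comp L.contDiff, fun k => ?_⟩
  obtain ⟨C, hC⟩ := hb k
  refine ⟨C * ∏ _j : Fin k, ‖L‖, fun x => ?_⟩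
  have := L.iteratedFDeriv_comp_right hu x (i := k) (by exact_mod_cast le_top)
  change ‖iteratedFDeriv ℝ k (u ∘ L) x‖ ≤ _
  rw [this]
  refine (ContinuousMultilinearMap.norm_compContinuousLinearMap_le _ _).trans ?_
  exact mul_le_mul_of_nonneg_right (hC _) (Finset.prod_nonneg fun _ _ => norm_nonneg _)

theorem pds_ofFn (hf : BSmooth f) {k : ℕ} (I : Fin k → ℕ) :
    GaussSobolev.pds (List.ofFn I) f = fun x => iteratedFDeriv ℝ k f x (fun j => e (I j)) := by
  induction k with
  | zero => ext x; simp [GaussSobolev.pds]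
  | succ k ih =>
    rw [List.ofFn_succ]
    change GaussSobolev.pd (I 0) (GaussSobolev.pds (List.ofFn fun j => I j.succ) f) = _
    have hd : Differentiable ℝ (iteratedFDeriv ℝ k f) :=
      hf.contDiff.differentiable_iteratedFDeriv (by exact_mod_cast WithTop.coe_lt_top _)
    rw [pd_eq_fderiv (hf.pds _).differentiable, ih]
    ext x
    rw [iteratedFDeriv_succ_apply_left]
    rw [fderiv_continuousMultilinear_apply_const (hd x)]
    rfl

/-- The constant does not depend on `I`: iterated partials are values of one Fréchet derivative at
unit vectors. This uniformity makes the weighted sums over all multi-indices finite. -/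
theorem abs_pds_le (hf : BSmooth f) (k : ℕ) :
    ∃ C : ℝ, 0 ≤ C ∧ ∀ (I : Fin k → ℕ) (x : Ell2), |GaussSobolev.pds (List.ofFn I) f x| ≤ C := by
  obtain ⟨C, hC⟩ := hf.bounded k
  refine ⟨C, (norm_nonneg _).trans (hC 0), fun I x => ?_⟩
  rw [hf.pds_ofFn]
  refine ((iteratedFDeriv ℝ k f x).le_opNorm _).trans ?_
  simpa [norm_e] using hC x

theorem isCFSmooth (hf : BSmooth f) : IsCFSmooth f where
  exists_pd I i x := (hf.pds I).hasPartialAt i x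
  measurable I := (hf.pds I).continuous.measurable
  fContinuous I x l _ := (hf.pds I).continuous.comp (by fun_prop)
  bounded I _ := by
    obtain ⟨C, -, hC⟩ := (hf.pds I).exists_bound
    exact ⟨C, hC⟩

end BSmooth

/-! ### Weighted sums over multi-indices, and a criterion for test functions -/

theorem ENNReal_tsum_prod_eq_pow (b : ℕ → ℝ≥0∞) (k : ℕ) :
    ∑' I : Fin k → ℕ, ∏ j, b (I j) = (∑' i, b i) ^ k := by
  induction k with
  | zero => simp
  | succ k ih =>
    rw [← (Fin.consEquiv fun _ => ℕ).tsum_eq, ENNReal.tsum_prod']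
    simp only [Fin.consEquiv_apply, Fin.prod_univ_succ, Fin.cons_zero, Fin.cons_succ]
    simp_rw [ENNReal.tsum_mul_left, ih]
    rw [ENNReal.tsum_mul_right, pow_succ']

theorem le_one_of_tsum_lt_one {a : ℕ → ℝ} (ha : ∀ i, 0 < a i) (hs : Summable a)
    (h1 : ∑' i, a i < 1) (i : ℕ) : a i ≤ 1 :=
  (hs.le_tsum i (fun j _ => (ha j).le)).trans h1.le

theorem tsum_ofReal_rpow_lt_top {a : ℕ → ℝ} (ha : ∀ i, 0 < a i) (hs : Summable a)
    (h1 : ∑' i, a i < 1) {p : ℝ} (hp : 1 ≤ p) : ∑' i, ENNReal.ofReal (a i ^ p) < ∞ := by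
  have hle : ∀ i, a i ^ p ≤ a i := fun i => by
    have := Real.rpow_le_rpow_of_exponent_ge (ha i) (le_one_of_tsum_lt_one ha hs h1 i) hp
    simpa using this
  refine (ENNReal.tsum_le_tsum fun i => ENNReal.ofReal_le_ofReal (hle i)).trans_lt ?_
  rw [← ENNReal.ofReal_tsum_of_nonneg (fun i => (ha i).le) hs]
  exact ENNReal.ofReal_lt_top

theorem BSmooth.isTest {a : ℕ → ℝ} (ha : ∀ i, 0 < a i) (hs : Summable a) (h1 : ∑' i, a i < 1)
    {f : Ell2 → ℝ} (hf : BSmooth f) {R : ℝ} (hR : ∀ x, f x ≠ 0 → ‖x‖ < R) : IsTest a f where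
  smooth := hf.isCFSmooth
  sup_lt_top k _ := by
    obtain ⟨C, hC0, hC⟩ := hf.abs_pds_le k
    have hfin : (∑' i, ENNReal.ofReal (a i ^ (2 : ℝ))) ^ k * ENNReal.ofReal (C ^ 2) < ∞ :=
      ENNReal.mul_lt_top (ENNReal.pow_lt_top (tsum_ofReal_rpow_lt_top ha hs h1 (by norm_num)))
        ENNReal.ofReal_lt_top
    refine lt_of_le_of_lt (iSup_le fun x => ?_) hfin
    rw [← ENNReal_tsum_prod_eq_pow, ← ENNReal.tsum_mul_right]
    refine ENNReal.tsum_le_tsum fun I => ?_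
    rw [← ENNReal.ofReal_prod_of_nonneg (fun i _ => by have := ha (I i); positivity),
      ← ENNReal.ofReal_mul (Finset.prod_nonneg fun i _ => by have := ha (I i); positivity)]
    refine ENNReal.ofReal_le_ofReal ?_
    simp only [Real.rpow_two]
    refine mul_le_mul_of_nonneg_left ?_ (Finset.prod_nonneg fun i _ => by positivity)
    exact pow_le_pow_left₀ (abs_nonneg _) (hC I x) 2
  support := by
    refine ⟨1, max R 1, one_pos, by positivity, Set.subset_univ _, fun x hx => ?_⟩
    rw [mem_ball_zero_iff]
    exact (hR x hx).trans_le (le_max_left _ _)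

/-- A smooth cut-off function of the norm on `ℓ²`. -/
def radial (x : Ell2) : ℝ := Real.smoothTransition (2 - ‖x‖ ^ 2)

/-- The derivative of the squared norm is twice the inner product with the point, the second
derivative is constant, and the higher ones vanish. The crude bound `4 ^ n` has the geometric form
required by the estimate for derivatives of a composition. -/
theorem norm_iteratedFDeriv_normSq_le (x : Ell2) (hx : ‖x‖ ≤ 2) (n : ℕ) (hn : 1 ≤ n) :
    ‖iteratedFDeriv ℝ n (fun y : Ell2 => ‖y‖ ^ 2) x‖ ≤ 4 ^ n := by
  obtain ⟨k, rfl⟩ := Nat.exists_eq_add_of_le' hn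
  rw [← norm_iteratedFDeriv_fderiv]
  have h : fderiv ℝ (fun y : Ell2 => ‖y‖ ^ 2) = ⇑((2 : ℝ) • innerSL ℝ (E := Ell2)) := by
    ext y z
    simp [fderiv_norm_sq_apply]
  rw [h]
  have hnorm : ‖(2 : ℝ) • innerSL ℝ (E := Ell2)‖ ≤ 2 := by
    refine ContinuousLinearMap.opNorm_le_bound _ (by norm_num) fun y => ?_
    rw [smul_apply, norm_smul]
    simp
  rcases k with _ | _ | k
  · rw [norm_iteratedFDeriv_zero]
    refine (ContinuousLinearMap.le_of_opNorm_le _ hnorm x).trans ?_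
    norm_num; linarith
  · have : ‖iteratedFDeriv ℝ (0 + 1) (⇑((2 : ℝ) • innerSL ℝ (E := Ell2))) x‖ = ‖fderiv ℝ (⇑((2 : ℝ) • innerSL ℝ (E := Ell2))) x‖ := by
      rw [← norm_iteratedFDeriv_fderiv, norm_iteratedFDeriv_zero]
    rw [this, ContinuousLinearMap.fderiv]
    exact hnorm.trans (by norm_num)
  · rw [← norm_iteratedFDeriv_fderiv]
    have : fderiv ℝ (⇑((2 : ℝ) • innerSL ℝ (E := Ell2))) = fun _ => (2 : ℝ) • innerSL ℝ (E := Ell2) :=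
      funext fun y => ContinuousLinearMap.fderiv _
    rw [this, iteratedFDeriv_const_of_ne (by omega)]
    simp

theorem radial_eq_zero {x : Ell2} (hx : 2 ≤ ‖x‖) : radial x = 0 :=
  Real.smoothTransition.zero_of_nonpos (by nlinarith)

theorem radial_eq_one {x : Ell2} (hx : ‖x‖ ≤ 1) : radial x = 1 :=
  Real.smoothTransition.one_of_one_le (by nlinarith [norm_nonneg x])

/-- Balls of `ℓ²` are not compact, so bounded support alone does not bound the derivatives.
Compactness is used only for the one-variable profile on `[0, 4]`, the range of the squared norm on
the ball of radius `2`; outside that ball the function vanishes identically. -/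
theorem bSmooth_radial : BSmooth radial := by
  have hq : ContDiff ℝ C∞ fun y : Ell2 => ‖y‖ ^ 2 := contDiff_norm_sq ℝ
  have hg : ContDiff ℝ C∞ fun s : ℝ => Real.smoothTransition (2 - s) :=
    Real.smoothTransition.contDiff.comp (contDiff_const.sub contDiff_id)
  refine ⟨hg.comp hq, fun n => ?_⟩
  have hC : ∀ i : ℕ, ∃ C : ℝ, ∀ s ∈ Set.Icc (0 : ℝ) 4,
      ‖iteratedFDeriv ℝ i (fun s : ℝ => Real.smoothTransition (2 - s)) s‖ ≤ C := fun i =>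
    isCompact_Icc.exists_bound_of_continuousOn
      (hg.continuous_iteratedFDeriv (by exact_mod_cast le_top)).continuousOn
  choose C hC using hC
  have hC0 : ∀ i, 0 ≤ C i := fun i => (norm_nonneg _).trans (hC i 0 (by norm_num))
  refine ⟨n.factorial * (∑ i ∈ Finset.range (n + 1), C i) * 4 ^ n, fun x => ?_⟩
  by_cases hx : ‖x‖ ≤ 2
  · refine norm_iteratedFDeriv_comp_le (N := C∞) hg hq (by exact_mod_cast le_top) x
      (fun i hi => ?_) (fun i hi _ => norm_iteratedFDeriv_normSq_le x hx i hi)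
    refine (hC i _ ⟨by positivity, by nlinarith [norm_nonneg x]⟩).trans ?_
    exact Finset.single_le_sum (f := C) (fun j _ => hC0 j) (by simp; omega)
  · have h0 : radial =ᶠ[𝓝 x] fun _ => 0 := by
      filter_upwards [(isOpen_lt continuous_const continuous_norm).mem_nhds (not_le.1 hx)] with y hy
      exact radial_eq_zero (le_of_lt hy)
    rw [(Filter.EventuallyEq.iteratedFDeriv ℝ h0 n).eq_of_nhds]
    have : iteratedFDeriv ℝ n (fun _ : Ell2 => (0 : ℝ)) x = 0 := by
      exact congrFun (iteratedFDeriv_fun_zero (𝕜 := ℝ) (E := Ell2) (F := ℝ) (n := n)) x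
    rw [this, norm_zero]
    have := Finset.sum_nonneg fun i (_ : i ∈ Finset.range (n + 1)) => hC0 i
    positivity

/-- The cut-off function of the norm at scale `N + 1`. -/
def cut (N : ℕ) (x : Ell2) : ℝ := radial (((N : ℝ) + 1)⁻¹ • x)

theorem bSmooth_cut (N : ℕ) : BSmooth (cut N) :=
  BSmooth.comp_clm bSmooth_radial.contDiff bSmooth_radial.bounded
    (((N : ℝ) + 1)⁻¹ • ContinuousLinearMap.id ℝ Ell2)

theorem cut_support (N : ℕ) {x : Ell2} (hx : cut N x ≠ 0) : ‖x‖ < 2 * (N + 1) := by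
  by_contra! h
  refine hx (radial_eq_zero ?_)
  rw [norm_smul, norm_inv, Real.norm_of_nonneg (by positivity), le_inv_mul_iff₀ (by positivity)]
  linarith

theorem cut_eq_one {N : ℕ} {x : Ell2} (hx : ‖x‖ ≤ N + 1) : cut N x = 1 := by
  refine radial_eq_one ?_
  rw [norm_smul, norm_inv, Real.norm_of_nonneg (by positivity), inv_mul_le_iff₀ (by positivity)]
  linarith

theorem abs_cut_le (N : ℕ) (x : Ell2) : |cut N x| ≤ 1 := by
  unfold cut radial
  rw [abs_of_nonneg (Real.smoothTransition.nonneg _)]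
  exact Real.smoothTransition.le_one _

/-- The factor produced by scaling is what makes the derivative of the cut-off disappear in the
limit. -/
theorem pd_cut (N i : ℕ) (x : Ell2) :
    pd i (cut N) x = ((N : ℝ) + 1)⁻¹ * pd i radial (((N : ℝ) + 1)⁻¹ • x) := by
  rw [pd_eq_fderiv (bSmooth_cut N).differentiable, pd_eq_fderiv bSmooth_radial.differentiable]
  have h := ((bSmooth_radial.differentiable (((N : ℝ) + 1)⁻¹ • x)).hasFDerivAt).comp x
    (((N : ℝ) + 1)⁻¹ • ContinuousLinearMap.id ℝ Ell2).hasFDerivAt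
  have : fderiv ℝ (cut N) x = _ := h.fderiv
  simp [this]

theorem tendsto_cut (x : Ell2) : Tendsto (fun N => cut N x) atTop (𝓝 1) := by
  obtain ⟨M, hM⟩ := exists_nat_ge ‖x‖
  refine tendsto_const_nhds.congr' ?_
  filter_upwards [eventually_ge_atTop M] with N hN
  exact (cut_eq_one (by have : (M : ℝ) ≤ N := by exact_mod_cast hN
                        linarith)).symm

theorem exists_bound_pd_cut (i : ℕ) : ∃ C : ℝ, 0 ≤ C ∧ ∀ N x, |pd i (cut N) x| ≤ C * ((N : ℝ) + 1)⁻¹ := by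
  obtain ⟨C, h0, hC⟩ := (bSmooth_radial.pd i).exists_bound
  refine ⟨C, h0, fun N x => ?_⟩
  rw [pd_cut, abs_mul, abs_of_nonneg (by positivity), mul_comm]
  exact mul_le_mul_of_nonneg_right (hC _) (by positivity)

theorem BSmooth.pd_mul {f g : Ell2 → ℝ} (hf : BSmooth f) (hg : BSmooth g) (i : ℕ) (x : Ell2) :
    GaussSobolev.pd i (fun y => f y * g y) x
      = GaussSobolev.pd i f x * g x + f x * GaussSobolev.pd i g x := by
  have := ((hf.hasPartialAt i x).hasDerivAt.mul (hg.hasPartialAt i x).hasDerivAt).deriv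
  simpa [GaussSobolev.pd, Pi.mul_def] using this

/-! ### The Gaussian measure on `ℓ²` -/

/-- The one-dimensional marginals of `P a`. -/
abbrev gaussC (a : ℕ → ℝ) (i : ℕ) : Measure ℝ := gaussianReal 0 (Real.toNNReal (a i ^ 2))

theorem range_coords_ae {a : ℕ → ℝ} (hP : IsProbabilityMeasure (P a)) :
    ∀ᵐ x ∂(gaussProd a), x ∈ Set.range coords := by
  have hg : IsProbabilityMeasure (gaussProd a) := by unfold gaussProd; infer_instance
  have h := hP.measure_univ
  rw [P, measurableEmbedding_coords.comap_apply, Set.image_univ] at h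
  exact (prob_compl_eq_zero_iff measurableEmbedding_coords.measurableSet_range).2 h

theorem map_coords_P {a : ℕ → ℝ} (hP : IsProbabilityMeasure (P a)) :
    (P a).map coords = gaussProd a := by
  rw [P, measurableEmbedding_coords.map_comap]
  exact Measure.restrict_eq_self_of_ae_mem (range_coords_ae hP)

/-- Measures on `ℓ²` can thus be identified through their values on finite-dimensional boxes of
sequences. -/
theorem eq_P_of_map_coords {a : ℕ → ℝ} {μ : Measure Ell2} (h : μ.map coords = gaussProd a) :
    μ = P a := by
  rw [P, ← h, measurableEmbedding_coords.comap_map]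

theorem P_box {a : ℕ → ℝ} (hP : IsProbabilityMeasure (P a)) (s : Finset ℕ) {t : ℕ → Set ℝ}
    (ht : ∀ i, MeasurableSet (t i)) :
    P a {x | ∀ i ∈ s, x i ∈ t i} = ∏ i ∈ s, gaussC a i (t i) := by
  have h1 : MeasurableSet (Set.pi (s : Set ℕ) t) :=
    MeasurableSet.pi s.countable_toSet fun i _ => ht i
  have h := Measure.map_apply (μ := P a) continuous_coords.measurable h1
  rw [map_coords_P hP, gaussProd, Measure.infinitePi_pi _ fun i _ => ht i] at h
  rw [h]
  rfl

/-- The point with coordinates `x j` for `j ∈ A` and `w j` for `j ∉ A`. -/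
def mix (A : Finset ℕ) (x w : Ell2) : Ell2 := w + ∑ j ∈ A, (x j - w j) • e j

theorem coe_sum {ι : Type*} (s : Finset ι) (f : ι → Ell2) (i : ℕ) :
    (∑ j ∈ s, f j) i = ∑ j ∈ s, f j i := by
  classical
  induction s using Finset.induction_on with
  | empty => rfl
  | insert j s hj ih => rw [Finset.sum_insert hj, Finset.sum_insert hj, coe_add, ih]

theorem mix_apply (A : Finset ℕ) (x w : Ell2) (i : ℕ) :
    mix A x w i = if i ∈ A then x i else w i := by
  simp only [mix, coe_add, coe_sum, coe_smul, e_apply]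
  split_ifs with h <;> simp [h]

theorem measurable_mix (A : Finset ℕ) : Measurable fun q : Ell2 × Ell2 => mix A q.1 q.2 := by
  unfold mix
  have : ∀ j, Measurable fun q : Ell2 × Ell2 => (q.1 j - q.2 j) • e j := fun j =>
    (((measurable_coord j).comp measurable_fst).sub
      ((measurable_coord j).comp measurable_snd)).smul_const _
  exact measurable_snd.add (Finset.measurable_sum _ fun j _ => this j)

/-- Resampling the coordinates outside `A` from an independent copy keeps the law, since the
coordinates are independent: the preimage of a box is a product of two boxes. This replaces every
splitting of `P` into a product of marginals. -/
theorem measurePreserving_mix {a : ℕ → ℝ} (hP : IsProbabilityMeasure (P a)) (A : Finset ℕ) :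
    MeasurePreserving (fun q : Ell2 × Ell2 => mix A q.1 q.2) ((P a).prod (P a)) (P a) := by
  refine ⟨measurable_mix A, eq_P_of_map_coords ?_⟩
  refine Measure.eq_infinitePi _ fun s t ht => ?_
  have h1 : MeasurableSet (Set.pi (s : Set ℕ) t) :=
    MeasurableSet.pi s.countable_toSet fun i _ => ht i
  rw [Measure.map_map continuous_coords.measurable (measurable_mix A),
    Measure.map_apply (continuous_coords.measurable.comp (measurable_mix A)) h1]
  have h2 : (coords ∘ fun q : Ell2 × Ell2 => mix A q.1 q.2) ⁻¹' Set.pi (s : Set ℕ) t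
      = {x : Ell2 | ∀ i ∈ s.filter (· ∈ A), x i ∈ t i} ×ˢ
        {x : Ell2 | ∀ i ∈ s.filter (· ∉ A), x i ∈ t i} := by
    ext ⟨x, w⟩
    simp only [Set.mem_preimage, Function.comp_apply, Set.mem_pi, coords, mix_apply,
      Set.mem_prod, Set.mem_ofPred_eq, Finset.mem_filter, SetLike.mem_coe]
    constructor
    · intro h
      exact ⟨fun i hi => by simpa [hi.2] using h i hi.1, fun i hi => by simpa [hi.2] using h i hi.1⟩
    · rintro ⟨h3, h4⟩ i hi
      split_ifs with hA
      · exact h3 i ⟨hi, hA⟩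
      · exact h4 i ⟨hi, hA⟩
  rw [h2, Measure.prod_prod, P_box hP _ ht, P_box hP _ ht, Finset.prod_filter_mul_prod_filter_not]

theorem measurePreserving_coord {a : ℕ → ℝ} (hP : IsProbabilityMeasure (P a)) (i : ℕ) :
    MeasurePreserving (fun x : Ell2 => x i) (P a) (gaussC a i) := by
  refine ⟨measurable_coord i, ?_⟩
  ext t ht
  rw [Measure.map_apply (measurable_coord i) ht]
  have := P_box hP {i} (t := fun _ => t) fun _ => ht
  simpa using! this

/-- The projection on the first `n` coordinates. -/
def proj (n : ℕ) : Ell2 →L[ℝ] (Fin n → ℝ) :=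
  ContinuousLinearMap.pi fun j =>
    LinearMap.mkContinuous
      { toFun := fun x : Ell2 => x j, map_add' := fun _ _ => rfl, map_smul' := fun _ _ => rfl } 1
      fun x => (abs_coord_le x j).trans_eq (one_mul _).symm

theorem proj_apply (n : ℕ) (x : Ell2) (j : Fin n) : proj n x j = x j := rfl

/-- The standard Gaussian marginal on the first `n` coordinates. -/
abbrev gaussN (a : ℕ → ℝ) (n : ℕ) : Measure (Fin n → ℝ) := Measure.pi fun j => gaussC a j

theorem measurePreserving_proj {a : ℕ → ℝ} (hP : IsProbabilityMeasure (P a)) (n : ℕ) :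
    MeasurePreserving (proj n) (P a) (gaussN a n) := by
  refine ⟨(proj n).continuous.measurable, (Measure.pi_eq fun t ht => ?_).symm⟩
  rw [Measure.map_apply (proj n).continuous.measurable (MeasurableSet.univ_pi ht)]
  have h := P_box hP (Finset.range n) (t := fun i => if hi : i < n then t ⟨i, hi⟩ else Set.univ)
    (fun i => by split_ifs with hi; exacts [ht _, MeasurableSet.univ])
  rw [Finset.prod_range] at h
  simp only [Fin.is_lt, dif_pos, Fin.eta] at h
  rw [← h]
  congr 1
  ext x
  simp only [Set.mem_preimage, Set.mem_pi, Set.mem_univ, true_imp_iff, Set.mem_ofPred_eq,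
    Finset.mem_range, proj_apply]
  constructor
  · intro hx i hi
    simpa [hi] using hx ⟨i, hi⟩
  · intro hx j
    simpa [j.2] using hx j j.2

/-- The embedding of `ℝⁿ` as the first `n` coordinates. -/
def emb (n : ℕ) (y : Fin n → ℝ) : Ell2 := ∑ j : Fin n, y j • e j

theorem emb_apply (n : ℕ) (y : Fin n → ℝ) (i : ℕ) :
    emb n y i = if h : i < n then y ⟨i, h⟩ else 0 := by
  simp only [emb, coe_sum, coe_smul, e_apply]
  split_ifs with h
  · rw [Finset.sum_eq_single ⟨i, h⟩]
    · simp
    · intro j _ hj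
      rw [if_neg, mul_zero]
      rintro rfl
      exact hj rfl
    · simp
  · refine Finset.sum_eq_zero fun j _ => ?_
    rw [if_neg, mul_zero]
    rintro rfl
    exact h j.2

theorem continuous_emb (n : ℕ) : Continuous (emb n) := by
  unfold emb
  fun_prop

theorem mix_emb_proj (n : ℕ) (x w : Ell2) :
    mix (Finset.range n) (emb n (proj n x)) w = mix (Finset.range n) x w := by
  ext i
  rw [mix_apply, mix_apply]
  split_ifs with h
  · rw [emb_apply, dif_pos (Finset.mem_range.1 h)]; rfl
  · rfl

/-- The error is a tail of the expansion of `x - w`, which converges in the norm of `ℓ²`. -/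
theorem tendsto_mix (x w : Ell2) :
    Tendsto (fun n => mix (Finset.range n) x w) atTop (𝓝 x) := by
  have h := (lp.hasSum_single (p := 2) (by norm_num) (x - w)).tendsto_sum_nat
  have h2 : ∀ n, mix (Finset.range n) x w
      = w + ∑ i ∈ Finset.range n, lp.single 2 i ((x - w : Ell2) i) := by
    intro n
    rw [mix]
    congr 1
    refine Finset.sum_congr rfl fun i _ => ?_
    rw [e, ← lp.single_smul, coe_sub]
    simp
  simp_rw [h2]
  simpa using h.const_add w

/-! ### Gaussian integration by parts -/

theorem hasDerivAt_gaussianPDFReal {v : ℝ≥0} (t : ℝ) :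
    HasDerivAt (gaussianPDFReal 0 v) (gaussianPDFReal 0 v t * (-(t / v))) t := by
  unfold gaussianPDFReal
  have h : HasDerivAt (fun x : ℝ => -(x - 0) ^ 2 / (2 * v)) (-(t / v)) t := by
    have := ((((hasDerivAt_id t).sub_const 0).pow 2).neg).div_const (2 * (v : ℝ))
    refine this.congr_deriv ?_
    simp
    ring
  have h2 := (h.exp).const_mul (√(2 * Real.pi * v))⁻¹
  refine h2.congr_deriv ?_
  ring

/-- Times the Gaussian density, the integrand is the exact derivative of density times `g`; both are
integrable by the two bounds. -/
theorem integral_gaussianReal_deriv_sub {v : ℝ≥0} (hv : v ≠ 0) {g g' : ℝ → ℝ}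
    (hg : ∀ t, HasDerivAt g (g' t) t) (hm : Measurable g') {C D : ℝ} (hC : ∀ t, |g t| ≤ C)
    (hD : ∀ t, |g' t - t / v * g t| ≤ D) :
    ∫ t, (g' t - t / v * g t) ∂(gaussianReal 0 v) = 0 := by
  have hgm : Measurable g := (continuous_iff_continuousAt.2 fun t => (hg t).continuousAt).measurable
  rw [integral_gaussianReal_eq_integral_smul hv]
  refine integral_eq_zero_of_hasDerivAt_of_integrable (f := fun t => gaussianPDFReal 0 v t * g t)
    (fun t => ?_) ?_ ?_
  · refine ((hasDerivAt_gaussianPDFReal t).mul (hg t)).congr_deriv ?_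
    rw [smul_eq_mul]
    ring
  · exact (integrable_gaussianPDFReal 0 v).mul_bdd (c := D) (by fun_prop)
      (Eventually.of_forall hD)
  · exact (integrable_gaussianPDFReal 0 v).mul_bdd (c := C) hgm.aestronglyMeasurable
      (Eventually.of_forall hC)

theorem hasDerivAt_line_of_forall {f : Ell2 → ℝ} {i : ℕ} (hf : ∀ x, HasPartialAt i f x) (x : Ell2)
    (s : ℝ) : HasDerivAt (fun t : ℝ => f (x + t • e i)) (pd i f (x + s • e i)) s := by
  have h := (hf (x + s • e i)).hasDerivAt
  have h2 : HasDerivAt (fun t : ℝ => t - s) 1 s := (hasDerivAt_id s).sub_const s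
  have h3 := HasDerivAt.comp s (h₂ := fun t : ℝ => f (x + s • e i + t • e i)) (by simpa using h) h2
  rw [mul_one] at h3
  refine h3.congr_of_eventuallyEq (Eventually.of_forall fun t => ?_)
  simp only [Function.comp_apply, add_assoc, ← add_smul]
  congr 3
  ring

/-- Resample all coordinates except the `i`-th. By Fubini, for a fixed sample `w` of the others what
remains is the one-dimensional identity along a line in direction `e i`. -/
theorem integral_pd_sub_coord_mul {a : ℕ → ℝ} (ha : ∀ i, 0 < a i)
    (hP : IsProbabilityMeasure (P a)) {h : Ell2 → ℝ} {i : ℕ} (hm : Measurable h)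
    (hd : ∀ x, HasPartialAt i h x) (hm' : Measurable (pd i h)) {C D : ℝ} (hC : ∀ x, |h x| ≤ C)
    (hD : ∀ x, |pd i h x - x i / a i ^ 2 * h x| ≤ D) :
    ∫ x, (pd i h x - x i / a i ^ 2 * h x) ∂(P a) = 0 := by
  set q : Ell2 → ℝ := fun x => pd i h x - x i / a i ^ 2 * h x with hq
  have hqm : Measurable q := hm'.sub (((measurable_coord i).div_const _).mul hm)
  have hmp := measurePreserving_mix hP {i}
  have h1 : ∫ x, q x ∂(P a) = ∫ z : Ell2 × Ell2, q (mix {i} z.1 z.2) ∂((P a).prod (P a)) := by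
    conv_lhs => rw [← hmp.map_eq]
    exact integral_map hmp.measurable.aemeasurable hqm.aestronglyMeasurable
  have hint : Integrable (fun z : Ell2 × Ell2 => q (mix {i} z.1 z.2)) ((P a).prod (P a)) :=
    Integrable.of_bound (hqm.comp hmp.measurable).aestronglyMeasurable D
      (Eventually.of_forall fun z => hD _)
  rw [h1, integral_prod_symm _ hint]
  refine integral_eq_zero_of_ae (Eventually.of_forall fun w => ?_)
  -- Removing the `i`-th coordinate of `w` makes the parameter of the line equal to the `i`-th
  -- coordinate itself.
  set x₀ : Ell2 := w + (-(w i)) • e i with hx₀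
  have hx : ∀ t : ℝ, (x₀ + t • e i : Ell2) i = t := fun t => by
    rw [hx₀, coe_add, coe_add, coe_smul, coe_smul, e_apply]
    simp
  have hmix : ∀ x : Ell2, mix {i} x w = x₀ + x i • e i := fun x => by
    simp only [mix, Finset.sum_singleton, hx₀, sub_eq_add_neg, add_smul]
    abel
  have hline : Measurable fun t : ℝ => x₀ + t • e i := by fun_prop
  have hv : ((Real.toNNReal (a i ^ 2) : ℝ≥0) : ℝ) = a i ^ 2 := Real.coe_toNNReal _ (sq_nonneg _)
  have h2 := integral_gaussianReal_deriv_sub (v := Real.toNNReal (a i ^ 2))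
    (by have := ha i; simp; positivity) (fun t => hasDerivAt_line_of_forall hd x₀ t)
    (hm'.comp hline) (fun t => hC _) (D := D)
    (fun t => by rw [hv]; have := hD (x₀ + t • e i); rwa [hx] at this)
  have hmp2 := measurePreserving_coord hP i
  have h3 : ∫ x, q (mix {i} x w) ∂(P a) = ∫ t, q (x₀ + t • e i) ∂(gaussC a i) := by
    simp_rw [hmix]
    conv_rhs => rw [← hmp2.map_eq]
    exact (integral_map (f := fun t : ℝ => q (x₀ + t • e i)) hmp2.measurable.aemeasurable
      (hqm.comp hline).aestronglyMeasurable).symm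
  change ∫ x, q (mix {i} x w) ∂(P a) = 0
  rw [h3, ← h2]
  refine integral_congr_ae (Eventually.of_forall fun t => ?_)
  simp only [hq, hx, hv]

/-- Bounded measurable functions with bounded support, all of whose partial derivatives of order
at most `n` exist and are again of this kind. -/
def BddSupp : ℕ → (Ell2 → ℝ) → Prop
  | 0, ψ => Measurable ψ ∧ (∃ C : ℝ, ∀ x, |ψ x| ≤ C) ∧ ∃ R : ℝ, ∀ x, ψ x ≠ 0 → ‖x‖ ≤ R
  | n + 1, ψ => BddSupp n ψ ∧ (∀ i x, HasPartialAt i ψ x) ∧ ∀ i, BddSupp n (pd i ψ)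

namespace BddSupp

theorem base {n : ℕ} {ψ : Ell2 → ℝ} (h : BddSupp n ψ) : BddSupp 0 ψ := by
  induction n with
  | zero => exact h
  | succ n ih => exact ih h.1

theorem add {n : ℕ} {ψ χ : Ell2 → ℝ} (h : BddSupp n ψ) (h' : BddSupp n χ) :
    BddSupp n fun x => ψ x + χ x := by
  induction n generalizing ψ χ with
  | zero =>
    obtain ⟨h1, ⟨C, hC⟩, R, hR⟩ := h
    obtain ⟨h1', ⟨C', hC'⟩, R', hR'⟩ := h'
    refine ⟨h1.add h1', ⟨C + C', fun x => (abs_add_le _ _).trans (add_le_add (hC x) (hC' x))⟩,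
      max R R', fun x hx => ?_⟩
    by_cases h0 : ψ x = 0
    · exact (hR' x fun h0' => hx (by simp [h0, h0'])).trans (le_max_right _ _)
    · exact (hR x h0).trans (le_max_left _ _)
  | succ n ih =>
    refine ⟨ih h.1 h'.1, fun i x => (h.2.1 i x).add (h'.2.1 i x), fun i => ?_⟩
    have : pd i (fun x => ψ x + χ x) = fun x => pd i ψ x + pd i χ x :=
      funext fun x => ((h.2.1 i x).hasDerivAt.add (h'.2.1 i x).hasDerivAt).deriv
    rw [this]
    exact ih (h.2.2 i) (h'.2.2 i)

theorem const_mul {n : ℕ} {ψ : Ell2 → ℝ} (h : BddSupp n ψ) (c : ℝ) :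
    BddSupp n fun x => c * ψ x := by
  induction n generalizing ψ with
  | zero =>
    obtain ⟨h1, ⟨C, hC⟩, R, hR⟩ := h
    refine ⟨h1.const_mul c, ⟨|c| * C, fun x => ?_⟩, R, fun x hx => hR x (right_ne_zero_of_mul hx)⟩
    rw [abs_mul]
    exact mul_le_mul_of_nonneg_left (hC x) (abs_nonneg _)
  | succ n ih =>
    refine ⟨ih h.1, fun i x => DifferentiableAt.const_mul (h.2.1 i x) c, fun i => ?_⟩
    have : pd i (fun x => c * ψ x) = fun x => c * pd i ψ x :=
      funext fun x => ((h.2.1 i x).hasDerivAt.const_mul c).deriv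
    rw [this]
    exact ih (h.2.2 i)

theorem hasDerivAt_coord (i j : ℕ) (x : Ell2) :
    HasDerivAt (fun t : ℝ => (x + t • e i : Ell2) j) (if j = i then 1 else 0) 0 := by
  simp only [coe_add, coe_smul, e_apply]
  simpa using ((hasDerivAt_id (0 : ℝ)).mul_const (if j = i then (1 : ℝ) else 0)).const_add (x j)

/-- A coordinate is unbounded on `ℓ²` but bounded on the support of `ψ`; for this the class records
bounded supports. -/
theorem coord_mul {n : ℕ} {ψ : Ell2 → ℝ} (h : BddSupp n ψ) (j : ℕ) :
    BddSupp n fun x => x j * ψ x := by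
  induction n generalizing ψ with
  | zero =>
    obtain ⟨h1, ⟨C, hC⟩, R, hR⟩ := h
    refine ⟨(measurable_coord j).mul h1, ⟨|R| * C, fun x => ?_⟩, R,
      fun x hx => hR x (right_ne_zero_of_mul hx)⟩
    have hC0 : 0 ≤ C := (abs_nonneg _).trans (hC x)
    by_cases h0 : ψ x = 0
    · simp only [h0, mul_zero, abs_zero]; positivity
    · rw [abs_mul]
      exact mul_le_mul ((abs_coord_le x j).trans ((hR x h0).trans (le_abs_self R))) (hC x)
        (abs_nonneg _) (abs_nonneg _)
  | succ n ih =>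
    have hd : ∀ i x, HasDerivAt (fun t : ℝ => (x + t • e i : Ell2) j * ψ (x + t • e i))
        ((if j = i then 1 else 0) * ψ x + x j * pd i ψ x) 0 := fun i x => by
      simpa using! (hasDerivAt_coord i j x).mul (h.2.1 i x).hasDerivAt
    refine ⟨ih h.1, fun i x => (hd i x).differentiableAt, fun i => ?_⟩
    have : pd i (fun x => x j * ψ x) = fun x => (if j = i then 1 else 0) * ψ x + x j * pd i ψ x :=
      funext fun x => (hd i x).deriv
    rw [this]
    exact (h.1.const_mul _).add (ih (h.2.2 i))

theorem pdStar {n : ℕ} {ψ : Ell2 → ℝ} (a : ℕ → ℝ) (h : BddSupp (n + 1) ψ) (i : ℕ) :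
    BddSupp n (pdStar a i ψ) := by
  have h2 := ((h.2.2 i).const_mul (-1)).add ((h.1.coord_mul i).const_mul (a i ^ 2)⁻¹)
  convert h2 using 2 with x
  rw [GaussSobolev.pdStar]
  ring

/-- The product rule gives `D(φψ) - (x_i / a_i²) φψ = (Dφ) ψ - φ (D* ψ)`, and the left side has
integral zero. -/
theorem integral_pd_mul {a : ℕ → ℝ} (ha : ∀ i, 0 < a i) (hP : IsProbabilityMeasure (P a))
    {φ ψ : Ell2 → ℝ} (hφ : BSmooth φ) (hψ : BddSupp 1 ψ) (i : ℕ) :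
    ∫ x, pd i φ x * ψ x ∂(P a) = ∫ x, φ x * GaussSobolev.pdStar a i ψ x ∂(P a) := by
  obtain ⟨C, hC0, hC⟩ := hφ.exists_bound
  obtain ⟨C', hC0', hC'⟩ := (hφ.pd i).exists_bound
  obtain ⟨h1, ⟨D, hD⟩, -⟩ := hψ.1
  obtain ⟨h2, ⟨E, hE⟩, -⟩ := hψ.pdStar a i
  have hd : ∀ x, HasDerivAt (fun t : ℝ => φ (x + t • e i) * ψ (x + t • e i))
      (pd i φ x * ψ x + φ x * pd i ψ x) 0 := fun x => by
    simpa using! (hφ.hasPartialAt i x).hasDerivAt.mul (hψ.2.1 i x).hasDerivAt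
  have hpd : pd i (fun x => φ x * ψ x) = fun x => pd i φ x * ψ x + φ x * pd i ψ x :=
    funext fun x => (hd x).deriv
  have hb1 : ∀ x, |pd i φ x * ψ x| ≤ C' * D := fun x => by
    rw [abs_mul]; exact mul_le_mul (hC' x) (hD x) (abs_nonneg _) hC0'
  have hb2 : ∀ x, |φ x * GaussSobolev.pdStar a i ψ x| ≤ C * E := fun x => by
    rw [abs_mul]; exact mul_le_mul (hC x) (hE x) (abs_nonneg _) hC0
  have heq : ∀ x, pd i (fun x => φ x * ψ x) x - x i / a i ^ 2 * (φ x * ψ x)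
      = pd i φ x * ψ x - φ x * GaussSobolev.pdStar a i ψ x := fun x => by
    rw [hpd, GaussSobolev.pdStar]; ring
  have h := integral_pd_sub_coord_mul ha hP (h := fun x => φ x * ψ x) (i := i)
    (hφ.continuous.measurable.mul h1) (fun x => (hd x).differentiableAt)
    (by rw [hpd]; exact ((hφ.pd i).continuous.measurable.mul h1).add
          (hφ.continuous.measurable.mul (hψ.2.2 i).base.1))
    (C := C * D) (D := C' * D + C * E)
    (fun x => by rw [abs_mul]; exact mul_le_mul (hC x) (hD x) (abs_nonneg _) hC0)
    (fun x => by rw [heq]; exact (abs_sub _ _).trans (add_le_add (hb1 x) (hb2 x)))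
  simp_rw [heq] at h
  rw [integral_sub] at h
  · linarith
  · exact Integrable.of_bound ((hφ.pd i).continuous.measurable.mul h1).aestronglyMeasurable _
      (Eventually.of_forall hb1)
  · exact Integrable.of_bound (hφ.continuous.measurable.mul h2).aestronglyMeasurable _
      (Eventually.of_forall hb2)

/-- In `pds (i :: I)` the derivative in direction `i` is outermost, and in `pdStars` its adjoint
acts first, so the induction moves one derivative at a time and loses one order of `ψ` each time. -/
theorem integral_pds_mul {a : ℕ → ℝ} (ha : ∀ i, 0 < a i) (hP : IsProbabilityMeasure (P a))
    {φ : Ell2 → ℝ} (hφ : BSmooth φ) (I : List ℕ) {ψ : Ell2 → ℝ} (hψ : BddSupp I.length ψ) :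
    ∫ x, pds I φ x * ψ x ∂(P a) = ∫ x, φ x * pdStars a I ψ x ∂(P a) := by
  induction I generalizing ψ with
  | nil => rfl
  | cons i I ih =>
    have h1 : BddSupp 1 ψ := by
      clear ih
      induction I generalizing ψ with
      | nil => exact hψ
      | cons j I ih => exact ih hψ.1
    rw [show pdStars a (i :: I) ψ = pdStars a I (GaussSobolev.pdStar a i ψ) from rfl,
      ← ih (hψ.pdStar a i)]
    exact integral_pd_mul ha hP (hφ.pds I) h1 i

end BddSupp

theorem pd_eq_zero_of_norm_gt {ψ : Ell2 → ℝ} {R : ℝ} (hR : ∀ x, ψ x ≠ 0 → ‖x‖ ≤ R) (i : ℕ)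
    (x : Ell2) (hx : pd i ψ x ≠ 0) : ‖x‖ ≤ R := by
  by_contra! h
  refine hx ?_
  have hcont : Continuous fun t : ℝ => ‖x + t • e i‖ := by fun_prop
  have h0 : (fun t : ℝ => ψ (x + t • e i)) =ᶠ[𝓝 0] fun _ => 0 := by
    filter_upwards [(isOpen_lt continuous_const hcont).mem_nhds (by simpa using h)] with t ht
    by_contra h1
    exact absurd (hR _ h1) (not_le.2 ht)
  rw [pd, h0.deriv_eq]
  simp

theorem IsTest.bddSupp {a : ℕ → ℝ} {φ : Ell2 → ℝ} (h : IsTest a φ) (n : ℕ) : BddSupp n φ := by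
  obtain ⟨-, R, -, hR0, -, hR⟩ := h.support
  have hR : ∀ x, φ x ≠ 0 → ‖x‖ ≤ R := fun x hx => by
    have := hR (show x ∈ φ ⁻¹' {0}ᶜ from hx)
    exact (mem_ball_zero_iff.1 this).le
  have hsupp : ∀ I : List ℕ, ∀ x, pds I φ x ≠ 0 → ‖x‖ ≤ R := fun I => by
    induction I with
    | nil => exact hR
    | cons i I ih => exact fun x hx => pd_eq_zero_of_norm_gt ih i x hx
  have hbdd : ∀ I : List ℕ, ∃ C : ℝ, ∀ x, |pds I φ x| ≤ C := fun I => by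
    rcases eq_or_ne I [] with rfl | hI
    -- `bounded` says nothing about `φ` itself. A move of length `2 * R + 1` along `e 0` leaves the
    -- support, so the mean value inequality bounds `φ` by its first derivative.
    · obtain ⟨C, hC⟩ := h.smooth.bounded [0] (by simp)
      have hC0 : 0 ≤ C := (abs_nonneg _).trans (hC 0)
      refine ⟨C * (2 * R + 1), fun x => ?_⟩
      by_cases hx : φ x = 0
      · simp only [pds, List.foldr_nil, hx, abs_zero]; positivity
      have h1 := Convex.norm_image_sub_le_of_norm_hasDerivWithin_le (s := Set.univ) (C := C)
        (x := 2 * R + 1) (y := 0)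
        (fun t _ => (hasDerivAt_line_of_forall (h.smooth.exists_pd [] 0) x t).hasDerivWithinAt)
        (fun t _ => hC _) convex_univ trivial trivial
      have h2 : φ (x + (2 * R + 1) • e 0) = 0 := by
        by_contra h3
        have h4 := hR _ h3
        have h5 := norm_sub_le (x + (2 * R + 1) • e 0) x
        rw [add_sub_cancel_left, norm_smul, norm_e, Real.norm_of_nonneg (by positivity)] at h5
        linarith [hR x hx]
      simp only [pds, List.foldr_nil, zero_smul, add_zero, h2, sub_zero, zero_sub, norm_neg,
        Real.norm_eq_abs] at h1 ⊢
      rwa [abs_of_nonneg (by positivity : 0 ≤ 2 * R + 1)] at h1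
    · exact h.smooth.bounded I hI
  have key : ∀ n, ∀ I : List ℕ, BddSupp n (pds I φ) := fun n => by
    induction n with
    | zero => exact fun I => ⟨h.smooth.measurable I, hbdd I, R, hsupp I⟩
    | succ n ih => exact fun I => ⟨ih I, h.smooth.exists_pd I, fun i => ih (i :: I)⟩
  exact key n []

theorem BSmooth.memLp {a : ℕ → ℝ} (hP : IsProbabilityMeasure (P a)) {φ : Ell2 → ℝ}
    (hφ : BSmooth φ) (q : ℝ≥0∞) : MemLp φ q (P a) := by
  obtain ⟨C, -, hC⟩ := hφ.exists_bound
  exact MemLp.of_bound hφ.continuous.aestronglyMeasurable C (Eventually.of_forall hC)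

theorem BSmooth.hasWeakDeriv {a : ℕ → ℝ} (ha : ∀ i, 0 < a i) (hP : IsProbabilityMeasure (P a))
    {φ : Ell2 → ℝ} (hφ : BSmooth φ) (p : ℝ) (I : List ℕ) :
    HasWeakDeriv a p I φ (GaussSobolev.pds I φ) :=
  ⟨(hφ.pds I).memLp hP _, fun _ hψ => BddSupp.integral_pds_mul ha hP hφ I (hψ.bddSupp _)⟩

/-! ### Averaging over the coordinates of large index -/

theorem toReal_ofReal_of_one_le {p : ℝ} (hp : 1 ≤ p) : (ENNReal.ofReal p).toReal = p :=
  ENNReal.toReal_ofReal (by linarith)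

theorem eLpNorm_ofReal_eq {α : Type*} [MeasurableSpace α] {p : ℝ} (hp : 1 ≤ p) (f : α → ℝ)
    (μ : Measure α) :
    eLpNorm f (ENNReal.ofReal p) μ = (∫⁻ x, ‖f x‖ₑ ^ p ∂μ) ^ (1 / p) := by
  rw [eLpNorm_eq_lintegral_rpow_enorm_toReal (by simp; linarith) ENNReal.ofReal_ne_top,
    toReal_ofReal_of_one_le hp]

theorem tendsto_eLpNorm_zero_of_dominated {α : Type*} [MeasurableSpace α] {μ : Measure α} {p : ℝ}
    (hp : 1 ≤ p) {F : ℕ → α → ℝ} {G : α → ℝ} (hF : ∀ n, AEStronglyMeasurable (F n) μ)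
    (hG : MemLp G (ENNReal.ofReal p) μ) (hle : ∀ n, ∀ᵐ x ∂μ, ‖F n x‖ ≤ G x)
    (hlim : ∀ᵐ x ∂μ, Tendsto (fun n => F n x) atTop (𝓝 0)) :
    Tendsto (fun n => eLpNorm (F n) (ENNReal.ofReal p) μ) atTop (𝓝 0) := by
  have hp0 : 0 < p := by linarith
  simp_rw [eLpNorm_ofReal_eq hp]
  have h1 : Tendsto (fun n => ∫⁻ x, ‖F n x‖ₑ ^ p ∂μ) atTop (𝓝 (∫⁻ _, 0 ∂μ)) := by
    refine tendsto_lintegral_of_dominated_convergence' (fun x => ‖G x‖ₑ ^ p)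
      (fun n => (hF n).enorm.pow_const p) (fun n => ?_) ?_ ?_
    · filter_upwards [hle n] with x hx
      refine ENNReal.rpow_le_rpow ?_ hp0.le
      rw [enorm_le_iff_norm_le]
      exact hx.trans (le_abs_self _)
    · have h2 := hG.2
      rw [eLpNorm_ofReal_eq hp] at h2
      exact ((ENNReal.rpow_lt_top_iff_of_pos (by positivity)).1 h2).ne
    · filter_upwards [hlim] with x hx
      have h2 := (hx.enorm).ennrpow_const p
      simpa [hp0] using h2
  have h2 := h1.ennrpow_const (1 / p)
  simpa [hp0] using h2

/-- Jensen for the probability measure `ν` in the inner variable, then Tonelli. It serves both for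
averaging over coordinates and for mollification. -/
theorem eLpNorm_integral_le {α β : Type*} [MeasurableSpace α] [MeasurableSpace β] {μ : Measure α}
    {ν : Measure β} [SFinite μ] [IsProbabilityMeasure ν] {p : ℝ} (hp : 1 ≤ p) {h : α × β → ℝ}
    (hm : Measurable h) :
    eLpNorm (fun x => ∫ w, h (x, w) ∂ν) (ENNReal.ofReal p) μ
      ≤ eLpNorm h (ENNReal.ofReal p) (μ.prod ν) := by
  have hp0 : 0 < p := by linarith
  rw [eLpNorm_ofReal_eq hp, eLpNorm_ofReal_eq hp]
  refine ENNReal.rpow_le_rpow ?_ (by positivity)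
  rw [lintegral_prod _ (by fun_prop)]
  refine lintegral_mono fun x => ?_
  refine (ENNReal.rpow_le_rpow (enorm_integral_le_lintegral_enorm _) hp0.le).trans ?_
  have h1 := eLpNorm'_le_eLpNorm'_of_exponent_le (μ := ν) (f := fun w => h (x, w)) one_pos hp
    (hm.comp measurable_prodMk_left).aestronglyMeasurable
  simp only [eLpNorm', ENNReal.rpow_one, div_one] at h1
  refine (ENNReal.rpow_le_rpow h1 hp0.le).trans_eq ?_
  rw [← ENNReal.rpow_mul, one_div_mul_cancel hp0.ne', ENNReal.rpow_one]

/-- Integration of `g` over all coordinates but the first `n`. -/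
def avg (a : ℕ → ℝ) (n : ℕ) (g : Ell2 → ℝ) (y : Fin n → ℝ) : ℝ :=
  ∫ w, g (mix (Finset.range n) (emb n y) w) ∂(P a)

theorem measurable_mix_emb (n : ℕ) :
    Measurable fun q : (Fin n → ℝ) × Ell2 => mix (Finset.range n) (emb n q.1) q.2 :=
  (measurable_mix _).comp (((continuous_emb n).measurable.comp measurable_fst).prodMk measurable_snd)

theorem proj_mix_emb (n : ℕ) (y : Fin n → ℝ) (w : Ell2) :
    proj n (mix (Finset.range n) (emb n y) w) = y := by
  ext j
  rw [proj_apply, mix_apply, if_pos (Finset.mem_range.2 j.2), emb_apply, dif_pos j.2]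

theorem measurePreserving_mix_emb {a : ℕ → ℝ} (hP : IsProbabilityMeasure (P a))
    (n : ℕ) :
    MeasurePreserving (fun q : (Fin n → ℝ) × Ell2 => mix (Finset.range n) (emb n q.1) q.2)
      ((gaussN a n).prod (P a)) (P a) := by
  refine ⟨measurable_mix_emb n, ?_⟩
  have h1 := ((measurePreserving_proj hP n).prod (MeasurePreserving.id (P a))).map_eq
  rw [← h1, Measure.map_map (measurable_mix_emb n)
    ((proj n).continuous.measurable.prodMap measurable_id)]
  convert (measurePreserving_mix hP (Finset.range n)).map_eq using 2
  ext1 q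
  exact mix_emb_proj n q.1 q.2

theorem measurable_avg {a : ℕ → ℝ} (hP : IsProbabilityMeasure (P a))
    {g : Ell2 → ℝ} (hg : Measurable g) (n : ℕ) : Measurable (avg a n g) := by
  have : StronglyMeasurable fun q : (Fin n → ℝ) × Ell2 =>
      g (mix (Finset.range n) (emb n q.1) q.2) :=
    (hg.comp (measurable_mix_emb n)).stronglyMeasurable
  exact this.integral_prod_right'.measurable

theorem eLpNorm_avg_le {a : ℕ → ℝ} (hP : IsProbabilityMeasure (P a))
    {p : ℝ} (hp : 1 ≤ p) {g : Ell2 → ℝ} (hg : Measurable g) (n : ℕ) :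
    eLpNorm (avg a n g) (ENNReal.ofReal p) (gaussN a n) ≤ eLpNorm g (ENNReal.ofReal p) (P a) := by
  refine (eLpNorm_integral_le hp (hg.comp (measurable_mix_emb n))).trans_eq ?_
  exact eLpNorm_comp_measurePreserving hg.aestronglyMeasurable (measurePreserving_mix_emb hP n)

theorem memLp_avg {a : ℕ → ℝ} (hP : IsProbabilityMeasure (P a))
    {p : ℝ} (hp : 1 ≤ p) {g : Ell2 → ℝ} (hg : Measurable g)
    (hL : MemLp g (ENNReal.ofReal p) (P a)) (n : ℕ) :
    MemLp (avg a n g) (ENNReal.ofReal p) (gaussN a n) :=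
  ⟨(measurable_avg hP hg n).aestronglyMeasurable, (eLpNorm_avg_le hP hp hg n).trans_lt hL.2⟩

/-- Averaging is adjoint to composition with `proj n`: the factor `φ (proj n x)` does not see the
resampled coordinates and leaves the inner integral. -/
theorem integral_avg_mul {a : ℕ → ℝ} (hP : IsProbabilityMeasure (P a))
    {g : Ell2 → ℝ} (hg : Measurable g) (hi : Integrable g (P a)) (n : ℕ)
    {φ : (Fin n → ℝ) → ℝ} (hφ : Measurable φ) {C : ℝ} (hC : ∀ y, |φ y| ≤ C) :
    ∫ y, avg a n g y * φ y ∂(gaussN a n) = ∫ x, g x * φ (proj n x) ∂(P a) := by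
  have hmp := measurePreserving_mix_emb hP n
  have hm : Measurable fun x => g x * φ (proj n x) :=
    hg.mul (hφ.comp (proj n).continuous.measurable)
  have hi2 : Integrable (fun x => g x * φ (proj n x)) (P a) :=
    hi.mul_bdd (c := C) (hφ.comp (proj n).continuous.measurable).aestronglyMeasurable
      (Eventually.of_forall fun x => hC _)
  have h1 := hmp.integrable_comp_of_integrable hi2
  have h2 : ∫ x, g x * φ (proj n x) ∂(P a)
      = ∫ q : (Fin n → ℝ) × Ell2, g (mix (Finset.range n) (emb n q.1) q.2) * φ q.1
        ∂((gaussN a n).prod (P a)) := by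
    conv_lhs => rw [← hmp.map_eq]
    rw [integral_map hmp.measurable.aemeasurable hm.aestronglyMeasurable]
    simp only [proj_mix_emb]
  rw [h2, integral_prod]
  · refine integral_congr_ae (Eventually.of_forall fun y => ?_)
    exact (integral_mul_const _ _).symm
  · simpa only [Function.comp_def, proj_mix_emb] using h1

/-- Jensen bounds the distance by the `L^p` norm of `g (mix x w) - g x` over independent `x` and
`w`. For bounded continuous `b` in place of `g` this tends to zero, as `mix x w → x` pointwise. The
errors from replacing `g` by `b` do not depend on `n`, because `mix` and the first projection both
preserve the law. -/
theorem tendsto_eLpNorm_avg_sub {a : ℕ → ℝ} (hP : IsProbabilityMeasure (P a))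
    {p : ℝ} (hp : 1 ≤ p) {g : Ell2 → ℝ} (hg : Measurable g)
    (hL : MemLp g (ENNReal.ofReal p) (P a)) :
    Tendsto (fun n => eLpNorm (fun x => avg a n g (proj n x) - g x) (ENNReal.ofReal p) (P a))
      atTop (𝓝 0) := by
  have hq1 : 1 ≤ ENNReal.ofReal p := by simpa using hp
  set μ := (P a).prod (P a)
  have hmp := fun n => measurePreserving_mix hP (Finset.range n)
  have hfst : MeasurePreserving (Prod.fst : Ell2 × Ell2 → Ell2) μ (P a) := measurePreserving_fst
  have hle : ∀ n, eLpNorm (fun x => avg a n g (proj n x) - g x) (ENNReal.ofReal p) (P a)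
      ≤ eLpNorm (fun q : Ell2 × Ell2 => g (mix (Finset.range n) q.1 q.2) - g q.1)
        (ENNReal.ofReal p) μ := fun n => by
    refine le_trans (le_of_eq ?_) (eLpNorm_integral_le hp
      (h := fun q : Ell2 × Ell2 => g (mix (Finset.range n) q.1 q.2) - g q.1)
      ((hg.comp (measurable_mix _)).sub (hg.comp measurable_fst)))
    refine eLpNorm_congr_ae ?_
    have hint := (hmp n).integrable_comp_of_integrable (hL.integrable hq1)
    filter_upwards [hint.prod_right_ae] with x hx
    rw [Function.comp_def] at hx
    simp only at hx ⊢
    rw [integral_sub hx (integrable_const _)]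
    simp [avg, mix_emb_proj]
  refine tendsto_of_tendsto_of_tendsto_of_le_of_le tendsto_const_nhds ?_
    (fun _ => zero_le) hle
  rw [ENNReal.tendsto_nhds_zero]
  intro ε hε
  have hε3 : ε / 3 ≠ 0 := by simp [hε.ne']
  obtain ⟨b, hb, hbL⟩ := hL.exists_boundedContinuous_eLpNorm_sub_le ENNReal.ofReal_ne_top hε3
  have hr : AEStronglyMeasurable (g - ⇑b) (P a) := hL.1.sub hbL.1
  have hbound : ∀ x, ‖b x‖ ≤ ‖b‖ := b.norm_coe_le_norm
  have hlim : Tendsto (fun n => eLpNorm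
      (fun q : Ell2 × Ell2 => b (mix (Finset.range n) q.1 q.2) - b q.1) (ENNReal.ofReal p) μ)
      atTop (𝓝 0) := by
    refine tendsto_eLpNorm_zero_of_dominated hp (G := fun _ => ‖b‖ + ‖b‖) (fun n => ?_)
      (memLp_const _) (fun n => Eventually.of_forall fun q => ?_)
      (Eventually.of_forall fun q => ?_)
    · exact ((b.continuous.measurable.comp (measurable_mix _)).sub
        (b.continuous.measurable.comp measurable_fst)).aestronglyMeasurable
    · exact (norm_sub_le _ _).trans (add_le_add (hbound _) (hbound _))
    · have := (b.continuous.tendsto q.1).comp (tendsto_mix q.1 q.2)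
      simpa using this.sub_const (b q.1)
  filter_upwards [(ENNReal.tendsto_nhds_zero.1 hlim) (ε / 3) (pos_iff_ne_zero.2 hε3)] with n hn
  have hdec : (fun q : Ell2 × Ell2 => g (mix (Finset.range n) q.1 q.2) - g q.1)
      = ((g - ⇑b) ∘ fun q : Ell2 × Ell2 => mix (Finset.range n) q.1 q.2)
        + ((fun q : Ell2 × Ell2 => b (mix (Finset.range n) q.1 q.2) - b q.1)
          - ((g - ⇑b) ∘ Prod.fst)) := by
    ext q
    simp
  have m1 : AEStronglyMeasurable ((g - ⇑b) ∘ fun q : Ell2 × Ell2 => mix (Finset.range n) q.1 q.2) μ :=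
    hr.comp_measurePreserving (hmp n)
  have m2 : AEStronglyMeasurable ((g - ⇑b) ∘ Prod.fst) μ := hr.comp_measurePreserving hfst
  have m3 : AEStronglyMeasurable
      (fun q : Ell2 × Ell2 => b (mix (Finset.range n) q.1 q.2) - b q.1) μ :=
    ((b.continuous.measurable.comp (measurable_mix _)).sub
        (b.continuous.measurable.comp measurable_fst)).aestronglyMeasurable
  rw [hdec]
  calc _ ≤ ε / 3 + (ε / 3 + ε / 3) := by
        refine (eLpNorm_add_le m1 (m3.sub m2) hq1).trans (add_le_add ?_ ?_)
        · rw [eLpNorm_comp_measurePreserving hr (hmp n)]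
          exact hb
        · refine (eLpNorm_sub_le m3 m2 hq1).trans (add_le_add hn ?_)
          rw [eLpNorm_comp_measurePreserving hr hfst]
          exact hb
    _ = ε := by rw [← add_assoc]; exact ENNReal.add_thirds ε

/-! ### Uniqueness of weak derivatives and smooth cylinder functions -/

theorem exists_bound_iteratedFDeriv {E : Type*} [NormedAddCommGroup E] [NormedSpace ℝ E] {u : E → ℝ}
    (hu : ContDiff ℝ C∞ u) (hc : HasCompactSupport u) (k : ℕ) :
    ∃ C : ℝ, ∀ x, ‖iteratedFDeriv ℝ k u x‖ ≤ C :=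
  (hu.continuous_iteratedFDeriv (by exact_mod_cast le_top)).bounded_above_of_compact_support
    (hc.iteratedFDeriv k)

theorem bSmooth_comp_proj {n : ℕ} {u : (Fin n → ℝ) → ℝ} (hu : ContDiff ℝ C∞ u)
    (hc : HasCompactSupport u) : BSmooth fun x => u (proj n x) :=
  BSmooth.comp_clm hu (exists_bound_iteratedFDeriv hu hc) (proj n)

theorem IsCylinder.bSmooth {φ : Ell2 → ℝ} (h : IsCylinder φ) : BSmooth φ := by
  obtain ⟨k, u, -, hu, hc, hφ⟩ := h
  convert bSmooth_comp_proj hu hc using 1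
  exact funext hφ

theorem HasWeakDeriv.nil {a : ℕ → ℝ} {p : ℝ} {f : Ell2 → ℝ}
    (hf : MemLp f (ENNReal.ofReal p) (P a)) : HasWeakDeriv a p [] f f :=
  ⟨hf, fun _ _ => rfl⟩

theorem tendsto_integral_mul_cut {a : ℕ → ℝ} {g : Ell2 → ℝ} (hg : Integrable g (P a)) :
    Tendsto (fun N => ∫ x, g x * cut N x ∂(P a)) atTop (𝓝 (∫ x, g x ∂(P a))) := by
  refine tendsto_integral_of_dominated_convergence (fun x => ‖g x‖) (fun N => ?_) hg.norm
    (fun N => Eventually.of_forall fun x => ?_) (Eventually.of_forall fun x => ?_)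
  · exact hg.1.mul (bSmooth_cut N).continuous.aestronglyMeasurable
  · rw [norm_mul]
    exact mul_le_of_le_one_right (norm_nonneg _) (abs_cut_le N x)
  · simpa using (tendsto_cut x).const_mul (g x)

theorem tendsto_integral_mul_pd_cut {a : ℕ → ℝ} {g : Ell2 → ℝ} (hg : Integrable g (P a)) (i : ℕ) :
    Tendsto (fun N => ∫ x, g x * pd i (cut N) x ∂(P a)) atTop (𝓝 0) := by
  obtain ⟨C, hC0, hC⟩ := exists_bound_pd_cut i
  have hlim : Tendsto (fun N : ℕ => C * ((N : ℝ) + 1)⁻¹) atTop (𝓝 0) := by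
    simpa [one_div] using (tendsto_one_div_add_atTop_nhds_zero_nat (𝕜 := ℝ)).const_mul C
  have h := tendsto_integral_of_dominated_convergence (μ := P a) (F := fun N x => g x * pd i (cut N) x)
    (f := fun _ => 0) (fun x => ‖g x‖ * C)
    (fun N => hg.1.mul ((bSmooth_cut N).pd i).continuous.aestronglyMeasurable)
    (hg.norm.mul_const C)
    (fun N => Eventually.of_forall fun x => by
      rw [norm_mul]
      refine mul_le_mul_of_nonneg_left ((hC N x).trans ?_) (norm_nonneg _)
      exact mul_le_of_le_one_right hC0 (inv_le_one_of_one_le₀ (by linarith [N.cast_nonneg (α := ℝ)])))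
    (Eventually.of_forall fun x => by
      have := (squeeze_zero_norm (fun N => hC N x) hlim).const_mul (g x)
      simpa using this)
  simpa using h

/-- This is how cylinder functions enter the definition of weak derivatives: they are bounded with
all derivatives, and only bounded support has to be supplied. -/
theorem isTest_mul_cut {a : ℕ → ℝ} (ha : ∀ i, 0 < a i) (hs : Summable a) (h1 : ∑' i, a i < 1)
    {f : Ell2 → ℝ} (hf : BSmooth f) (N : ℕ) : IsTest a fun x => f x * cut N x :=
  (hf.mul (bSmooth_cut N)).isTest ha hs h1 (R := 2 * (N + 1))
    fun _ hx => cut_support N (right_ne_zero_of_mul hx)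

/-- Testing with `u (proj n x) * cut N x` and letting `N → ∞` shows that every average of `g`
annihilates `C_c^∞`, hence vanishes almost everywhere. Since the averages converge to `g` in `L^1`,
so does `g`. -/
theorem ae_eq_zero_of_forall_isTest {a : ℕ → ℝ} (ha : ∀ i, 0 < a i) (hs : Summable a)
    (h1 : ∑' i, a i < 1) {g : Ell2 → ℝ} (hg : Integrable g (P a))
    (h : ∀ φ, IsTest a φ → ∫ x, g x * φ x ∂(P a) = 0) : g =ᵐ[P a] 0 := by
  have hP := isProbabilityMeasure_P a ha hs h1
  -- Averages integrate over slices, and their lemmas ask for a measurable function; a measurable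
  -- representative is enough.
  wlog hm : Measurable g generalizing g
  · have hae := hg.1.ae_eq_mk
    refine hae.trans (this (hg.congr hae) (fun φ hφ => ?_) hg.1.stronglyMeasurable_mk.measurable)
    rw [← h φ hφ]
    exact integral_congr_ae (hae.symm.mul (ae_eq_refl φ))
  have hL : MemLp g (ENNReal.ofReal 1) (P a) := by simpa [memLp_one_iff_integrable] using hg
  have h0 : ∀ n, avg a n g =ᵐ[gaussN a n] 0 := fun n => by
    have hi : Integrable (avg a n g) (gaussN a n) := by
      have := memLp_avg hP le_rfl hm hL n
      simpa [memLp_one_iff_integrable] using this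
    refine ae_eq_zero_of_integral_contDiff_smul_eq_zero hi.locallyIntegrable fun u hu hc => ?_
    obtain ⟨C, -, hC⟩ := (bSmooth_comp_proj hu hc).exists_bound
    have hC' : ∀ y, |u y| ≤ C := fun y => by simpa only [proj_mix_emb] using hC (mix (Finset.range n) (emb n y) 0)
    have h2 : ∫ x, g x * u (proj n x) ∂(P a) = 0 := by
      have hi2 : Integrable (fun x => g x * u (proj n x)) (P a) :=
        hg.mul_bdd (c := C) (bSmooth_comp_proj hu hc).continuous.aestronglyMeasurable
          (Eventually.of_forall hC)
      refine tendsto_nhds_unique (tendsto_integral_mul_cut hi2) (tendsto_const_nhds.congr fun N => ?_)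
      rw [← h _ (isTest_mul_cut ha hs h1 (bSmooth_comp_proj hu hc) N)]
      simp only [mul_assoc]
    rw [← integral_avg_mul hP hm hg n hu.continuous.measurable hC'] at h2
    simpa only [smul_eq_mul, mul_comm] using h2
  have h2 := tendsto_eLpNorm_avg_sub hP le_rfl hm hL
  have h3 : ∀ n, eLpNorm (fun x => avg a n g (proj n x) - g x) (ENNReal.ofReal 1) (P a)
      = eLpNorm g (ENNReal.ofReal 1) (P a) := fun n => by
    rw [← eLpNorm_neg]
    refine eLpNorm_congr_ae ?_
    filter_upwards [(measurePreserving_proj hP n).quasiMeasurePreserving.ae (h0 n)] with x hx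
    simp only [Pi.neg_apply, hx, Pi.zero_apply]
    ring
  simp_rw [h3] at h2
  exact (eLpNorm_eq_zero_iff hg.1 (by simp)).1 (tendsto_nhds_unique tendsto_const_nhds h2)

theorem BddSupp.pdStars {a : ℕ → ℝ} {I : List ℕ} {ψ : Ell2 → ℝ} (h : BddSupp I.length ψ) :
    BddSupp 0 (pdStars a I ψ) := by
  induction I generalizing ψ with
  | nil => exact h
  | cons i I ih => exact ih (h.pdStar a i)

theorem BddSupp.integrable_mul {a : ℕ → ℝ} {ψ f : Ell2 → ℝ} {n : ℕ} (h : BddSupp n ψ)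
    (hf : Integrable f (P a)) : Integrable (fun x => f x * ψ x) (P a) := by
  obtain ⟨h1, ⟨C, hC⟩, -⟩ := h.base
  exact hf.mul_bdd (c := C) h1.aestronglyMeasurable (Eventually.of_forall hC)

section

variable {a : ℕ → ℝ} {p : ℝ} {I : List ℕ} {f f' g g' : Ell2 → ℝ}

theorem MemLp_integrable_of_one_le (hP : IsProbabilityMeasure (P a)) (hp : 1 ≤ p)
    (h : MemLp f (ENNReal.ofReal p) (P a)) : Integrable f (P a) :=
  h.integrable (by simpa using hp)

theorem HasWeakDeriv.sub (hP : IsProbabilityMeasure (P a)) (hp : 1 ≤ p) (hf : Integrable f (P a))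
    (hf' : Integrable f' (P a)) (h : HasWeakDeriv a p I f g) (h' : HasWeakDeriv a p I f' g') :
    HasWeakDeriv a p I (fun x => f x - f' x) (fun x => g x - g' x) := by
  refine ⟨h.1.sub h'.1, fun φ hφ => ?_⟩
  have hb := hφ.bddSupp I.length
  have hb' := hb.pdStars (a := a)
  simp only [sub_mul]
  rw [integral_sub (hb.integrable_mul (MemLp_integrable_of_one_le hP hp h.1))
    (hb.integrable_mul (MemLp_integrable_of_one_le hP hp h'.1)),
    integral_sub (hb'.integrable_mul hf) (hb'.integrable_mul hf'), h.2 φ hφ, h'.2 φ hφ]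

theorem HasWeakDeriv.congr (h : HasWeakDeriv a p I f g) (hf : f =ᵐ[P a] f') (hg : g =ᵐ[P a] g') :
    HasWeakDeriv a p I f' g' := by
  refine ⟨h.1.ae_eq hg, fun φ hφ => ?_⟩
  exact (integral_congr_ae (hg.mul (ae_eq_refl φ))).symm.trans ((h.2 φ hφ).trans
    (integral_congr_ae (hf.mul (ae_eq_refl (GaussSobolev.pdStars a I φ)))))

/-- It makes the norm independent of the choice made in `weakDeriv`. -/
theorem HasWeakDeriv.unique (ha : ∀ i, 0 < a i) (hs : Summable a) (h1 : ∑' i, a i < 1)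
    (hp : 1 ≤ p) (h : HasWeakDeriv a p I f g) (h' : HasWeakDeriv a p I f g') : g =ᵐ[P a] g' := by
  have hP := isProbabilityMeasure_P a ha hs h1
  have hg := MemLp_integrable_of_one_le hP hp h.1
  have hg' := MemLp_integrable_of_one_le hP hp h'.1
  have h2 : (fun x => g x - g' x) =ᵐ[P a] 0 := by
    refine ae_eq_zero_of_forall_isTest ha hs h1 (hg.sub hg') fun φ hφ => ?_
    have hb := hφ.bddSupp 0
    simp only [sub_mul]
    rw [integral_sub (hb.integrable_mul hg) (hb.integrable_mul hg'), h.2 φ hφ, h'.2 φ hφ, sub_self]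
  filter_upwards [h2] with x hx
  exact sub_eq_zero.1 hx

theorem weakDeriv_spec (h : ∃ g, HasWeakDeriv a p I f g) :
    HasWeakDeriv a p I f (weakDeriv a p I f) := by
  rw [weakDeriv, dif_pos h]
  exact h.choose_spec

theorem HasWeakDeriv.weakDeriv_ae_eq (ha : ∀ i, 0 < a i) (hs : Summable a) (h1 : ∑' i, a i < 1)
    (hp : 1 ≤ p) (h : HasWeakDeriv a p I f g) : weakDeriv a p I f =ᵐ[P a] g :=
  (weakDeriv_spec ⟨g, h⟩).unique ha hs h1 hp h

end

theorem BSmooth.memW {a : ℕ → ℝ} (ha : ∀ i, 0 < a i) (hs : Summable a) (h1 : ∑' i, a i < 1)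
    (m : ℕ) {p : ℝ} (hp : 1 ≤ p) {φ : Ell2 → ℝ} (hφ : BSmooth φ) : MemW a m p φ := by
  have hP := isProbabilityMeasure_P a ha hs h1
  refine ⟨hφ.memLp hP _, fun k _ I => ⟨_, hφ.hasWeakDeriv ha hP p _⟩, ?_⟩
  refine ENNReal.sum_lt_top.2 fun k _ => ?_
  obtain ⟨C, hC0, hC⟩ := hφ.abs_pds_le k
  refine lt_of_le_of_lt (b := (∑' i, ENNReal.ofReal (a i ^ p)) ^ k * ENNReal.ofReal C ^ p) ?_
    (ENNReal.mul_lt_top (ENNReal.pow_lt_top (tsum_ofReal_rpow_lt_top ha hs h1 hp))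
      (ENNReal.rpow_lt_top_of_nonneg (by linarith) ENNReal.ofReal_ne_top))
  rw [← ENNReal_tsum_prod_eq_pow, ← ENNReal.tsum_mul_right]
  refine ENNReal.tsum_le_tsum fun I => mul_le_mul_right ?_ _
  have hae := (hφ.hasWeakDeriv ha hP p (List.ofFn I)).weakDeriv_ae_eq ha hs h1 hp
  calc _ ≤ ∫⁻ _, ENNReal.ofReal C ^ p ∂(P a) := by
        refine lintegral_mono_ae ?_
        filter_upwards [hae] with x hx
        rw [hx, Real.enorm_eq_ofReal_abs]
        exact ENNReal.rpow_le_rpow (ENNReal.ofReal_le_ofReal (hC I x)) (by linarith)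
    _ = _ := by simp

/-! ### Averages of weak derivatives -/

theorem pd_comp_proj {n : ℕ} {u : (Fin n → ℝ) → ℝ} (hu : Differentiable ℝ u) (i : ℕ) :
    pd i (fun x => u (proj n x)) = fun x => fderiv ℝ u (proj n x) (proj n (e i)) := by
  rw [pd_eq_fderiv (f := fun x => u (proj n x)) (hu.comp (proj n).differentiable)]
  ext x
  have : fderiv ℝ (fun x => u (proj n x)) x = _ :=
    ((hu (proj n x)).hasFDerivAt.comp x (proj n).hasFDerivAt).fderiv
  rw [this]
  rfl

/-- The partial derivative in direction `i` of a function of `n` variables; it vanishes for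
`i ≥ n`. -/
def dirD (n i : ℕ) (u : (Fin n → ℝ) → ℝ) (y : Fin n → ℝ) : ℝ := fderiv ℝ u y (proj n (e i))

theorem contDiff_dirD {n : ℕ} {u : (Fin n → ℝ) → ℝ} (hu : ContDiff ℝ C∞ u) (i : ℕ) :
    ContDiff ℝ C∞ (dirD n i u) := by
  have h1 : ContDiff ℝ C∞ (fderiv ℝ u) := hu.fderiv_right (by simp)
  exact h1.clm_apply contDiff_const

theorem hasCompactSupport_dirD {n : ℕ} {u : (Fin n → ℝ) → ℝ} (hc : HasCompactSupport u) (i : ℕ) :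
    HasCompactSupport (dirD n i u) :=
  hc.fderiv_apply (𝕜 := ℝ) _

/-- By duality both sides become integrals over `ℓ²` against cylinder functions. With the cut-off
inserted, `D_i^*` of the test function is again a test function, so the weak derivatives for `I` and
for `i :: I` can be compared. The only extra term contains the derivative of the cut-off and
vanishes in the limit. -/
theorem integral_avg_weakDeriv {a : ℕ → ℝ} (ha : ∀ i, 0 < a i) (hs : Summable a)
    (h1 : ∑' i, a i < 1) {p : ℝ} (hp : 1 ≤ p) {I : List ℕ} {i : ℕ} {f g g' : Ell2 → ℝ}
    (hg : Measurable g) (hg' : Measurable g') (h : HasWeakDeriv a p I f g)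
    (h' : HasWeakDeriv a p (i :: I) f g') {n : ℕ} (hi : i < n) {u : (Fin n → ℝ) → ℝ}
    (hu : ContDiff ℝ C∞ u) (hc : HasCompactSupport u) :
    ∫ y, avg a n g' y * u y ∂(gaussN a n)
      = ∫ y, avg a n g y * (-dirD n i u y + y ⟨i, hi⟩ / a i ^ 2 * u y) ∂(gaussN a n) := by
  have hP := isProbabilityMeasure_P a ha hs h1
  have hgi := MemLp_integrable_of_one_le hP hp h.1
  have hgi' := MemLp_integrable_of_one_le hP hp h'.1
  set w : (Fin n → ℝ) → ℝ := fun y => -dirD n i u y + y ⟨i, hi⟩ / a i ^ 2 * u y with hw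
  have hwd : ContDiff ℝ C∞ w :=
    (contDiff_dirD hu i).neg.add (((contDiff_apply ℝ ℝ _).div_const _).mul hu)
  have hwc : HasCompactSupport w := HasCompactSupport.add
    (HasCompactSupport.comp_left (g := fun t : ℝ => -t) (hasCompactSupport_dirD hc i) neg_zero)
    hc.mul_left
  have hub := bSmooth_comp_proj hu hc
  have hwb := bSmooth_comp_proj hwd hwc
  obtain ⟨C, -, hC⟩ := hub.exists_bound
  obtain ⟨D, -, hD⟩ := hwb.exists_bound
  rw [integral_avg_mul hP hg' hgi' n hu.continuous.measurable
      (C := C) (fun y => by simpa only [proj_mix_emb] using hC (mix (Finset.range n) (emb n y) 0)),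
    integral_avg_mul hP hg hgi n hwd.continuous.measurable
      (C := D) (fun y => by simpa only [proj_mix_emb] using hD (mix (Finset.range n) (emb n y) 0))]
  have hi1 : Integrable (fun x => g' x * u (proj n x)) (P a) :=
    hgi'.mul_bdd (c := C) hub.continuous.aestronglyMeasurable (Eventually.of_forall hC)
  have hi2 : Integrable (fun x => g x * w (proj n x)) (P a) :=
    hgi.mul_bdd (c := D) hwb.continuous.aestronglyMeasurable (Eventually.of_forall hD)
  have hi3 : Integrable (fun x => g x * u (proj n x)) (P a) :=
    hgi.mul_bdd (c := C) hub.continuous.aestronglyMeasurable (Eventually.of_forall hC)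
  have hlim := (tendsto_integral_mul_cut hi2).sub (tendsto_integral_mul_pd_cut hi3 i)
  rw [sub_zero] at hlim
  refine tendsto_nhds_unique (tendsto_integral_mul_cut hi1) (hlim.congr fun N => ?_)
  have hstar : pdStar a i (fun x => u (proj n x) * cut N x)
      = fun x => w (proj n x) * cut N x + -1 * (u (proj n x) * pd i (cut N) x) := by
    ext x
    rw [pdStar, hub.pd_mul (bSmooth_cut N), pd_comp_proj (hu.differentiable (by simp)), hw]
    simp only [dirD, proj_apply]
    ring
  -- The linear weight of `D_i^*` is harmless because it is absorbed in the compactly supported `w`.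
  -- The radius is enlarged by `1` since the support bound for a derivative is not strict.
  have htest : IsTest a (pdStar a i fun x => u (proj n x) * cut N x) := by
    rw [hstar]
    refine ((hwb.mul (bSmooth_cut N)).add ((hub.mul ((bSmooth_cut N).pd i)).const_mul (-1))).isTest
      ha hs h1 (R := 2 * (N + 1) + 1) fun x hx => ?_
    by_cases h0 : cut N x = 0
    · have h2 : pd i (cut N) x ≠ 0 := fun h2 => hx (by simp [h0, h2])
      linarith [pd_eq_zero_of_norm_gt (fun x hx => (cut_support N hx).le) i x h2]
    · linarith [cut_support N h0]
  -- The right-hand sides of `e1` and `e2` agree by definition, because the adjoint for the head of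
  -- `i :: I` acts first.
  have e1 := h'.2 _ (isTest_mul_cut ha hs h1 hub N)
  have e2 := h.2 _ htest
  have e3 : ∫ x, g' x * u (proj n x) * cut N x ∂(P a)
      = ∫ x, g x * pdStar a i (fun x => u (proj n x) * cut N x) x ∂(P a) := by
    rw [e2]
    simp only [mul_assoc]
    exact e1
  rw [e3, hstar, ← integral_sub]
  · refine integral_congr_ae (Eventually.of_forall fun x => ?_)
    simp only
    ring
  · exact hi2.mul_bdd (c := 1) (bSmooth_cut N).continuous.aestronglyMeasurable
      (Eventually.of_forall (abs_cut_le N))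
  · obtain ⟨K, -, hK⟩ := ((bSmooth_cut N).pd i).exists_bound
    exact hi3.mul_bdd (c := K) ((bSmooth_cut N).pd i).continuous.aestronglyMeasurable
      (Eventually.of_forall hK)

/-! ### Gaussian and Lebesgue measure in finitely many variables -/

/-- The exponent of the Gaussian density of `gaussN a n`. -/
def quad (a : ℕ → ℝ) (n : ℕ) (y : Fin n → ℝ) : ℝ := ∑ j : Fin n, y j ^ 2 / (2 * a j ^ 2)

/-- The normalising constant of the Gaussian density of `gaussN a n`. -/
def gaussConst (a : ℕ → ℝ) (n : ℕ) : ℝ := ∏ j : Fin n, (√(2 * Real.pi * a j ^ 2))⁻¹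

theorem contDiff_quad (a : ℕ → ℝ) (n : ℕ) : ContDiff ℝ C∞ (quad a n) := by
  unfold quad
  fun_prop

theorem quad_nonneg (a : ℕ → ℝ) (n : ℕ) (y : Fin n → ℝ) : 0 ≤ quad a n y :=
  Finset.sum_nonneg fun _ _ => by positivity

theorem gaussConst_pos {a : ℕ → ℝ} (ha : ∀ i, 0 < a i) (n : ℕ) : 0 < gaussConst a n :=
  Finset.prod_pos fun j _ => by
    have := ha j
    have := Real.pi_pos
    positivity

theorem gaussN_eq_withDensity {a : ℕ → ℝ} (ha : ∀ i, 0 < a i) (n : ℕ) :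
    gaussN a n = (volume : Measure (Fin n → ℝ)).withDensity
      fun y => ENNReal.ofReal (gaussConst a n * Real.exp (-quad a n y)) := by
  have hv : ∀ i, (Real.toNNReal (a i ^ 2)) ≠ 0 := fun i => by have := ha i; simp; positivity
  have hρ : ∀ y : Fin n → ℝ, gaussConst a n * Real.exp (-quad a n y)
      = ∏ j : Fin n, gaussianPDFReal 0 (Real.toNNReal (a j ^ 2)) (y j) := fun y => by
    rw [gaussConst, quad, ← Finset.sum_neg_distrib, Real.exp_sum, ← Finset.prod_mul_distrib]
    refine Finset.prod_congr rfl fun j _ => ?_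
    rw [gaussianPDFReal, Real.coe_toNNReal _ (sq_nonneg _), sub_zero, neg_div]
  simp_rw [hρ]
  refine Measure.pi_eq fun s hs => ?_
  have hi : ∀ j : Fin n, Integrable
      ((s j).indicator (gaussianPDFReal 0 (Real.toNNReal (a j ^ 2)))) volume := fun j =>
    (integrable_gaussianPDFReal _ _).indicator (hs j)
  have hind : ∀ y : Fin n → ℝ, (Set.univ.pi s).indicator
      (fun y => ENNReal.ofReal (∏ j : Fin n, gaussianPDFReal 0 (Real.toNNReal (a j ^ 2)) (y j))) y
      = ENNReal.ofReal
        (∏ j : Fin n, (s j).indicator (gaussianPDFReal 0 (Real.toNNReal (a j ^ 2))) (y j)) := fun y => by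
    by_cases hy : y ∈ Set.univ.pi s
    · rw [Set.indicator_of_mem hy]
      congr 1
      exact Finset.prod_congr rfl fun j _ => (Set.indicator_of_mem (hy j trivial) _).symm
    · rw [Set.indicator_of_notMem hy]
      simp only [Set.mem_pi, Set.mem_univ, true_imp_iff, not_forall] at hy
      obtain ⟨j, hj⟩ := hy
      rw [Finset.prod_eq_zero (Finset.mem_univ j) (Set.indicator_of_notMem hj _),
        ENNReal.ofReal_zero]
  have hnn : ∀ (j : Fin n) (t : ℝ),
      0 ≤ (s j).indicator (gaussianPDFReal 0 (Real.toNNReal (a j ^ 2))) t := fun j t =>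
    Set.indicator_nonneg (fun _ _ => gaussianPDFReal_nonneg _ _ _) t
  rw [withDensity_apply _ (MeasurableSet.univ_pi hs), ← lintegral_indicator (MeasurableSet.univ_pi hs)]
  simp_rw [hind]
  rw [volume_pi, ← ofReal_integral_eq_lintegral_ofReal (Integrable.fintype_prod hi)
      (Eventually.of_forall fun y => Finset.prod_nonneg fun j _ => hnn j _),
    integral_fintype_prod_eq_prod,
    ENNReal.ofReal_prod_of_nonneg fun j _ => integral_nonneg (hnn j)]
  refine Finset.prod_congr rfl fun j _ => ?_
  rw [gaussianReal_apply_eq_integral _ (hv j), integral_indicator (hs j)]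

theorem integral_gaussN {a : ℕ → ℝ} (ha : ∀ i, 0 < a i) (n : ℕ) (f : (Fin n → ℝ) → ℝ) :
    ∫ y, f y ∂(gaussN a n) = ∫ y, gaussConst a n * Real.exp (-quad a n y) * f y := by
  rw [gaussN_eq_withDensity ha, integral_withDensity_eq_integral_toReal_smul]
  · refine integral_congr_ae (Eventually.of_forall fun y => ?_)
    have := gaussConst_pos ha n
    simp only [smul_eq_mul]
    rw [ENNReal.toReal_ofReal (by positivity)]
  · have := (contDiff_quad a n).continuous
    fun_prop
  · simp

theorem gaussN_le_smul_volume {a : ℕ → ℝ} (ha : ∀ i, 0 < a i) (n : ℕ) :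
    gaussN a n ≤ ENNReal.ofReal (gaussConst a n) • (volume : Measure (Fin n → ℝ)) := by
  rw [gaussN_eq_withDensity ha, ← withDensity_const]
  refine withDensity_mono (Eventually.of_forall fun y => ENNReal.ofReal_le_ofReal ?_)
  refine mul_le_of_le_one_right (gaussConst_pos ha n).le (Real.exp_le_one_iff.2 ?_)
  linarith [quad_nonneg a n y]

/-- The Gaussian density is bounded below on compact sets; only there can Lebesgue measure be
controlled by `gaussN`. -/
theorem exists_volume_restrict_le {a : ℕ → ℝ} (ha : ∀ i, 0 < a i) (n : ℕ) {K : Set (Fin n → ℝ)}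
    (hK : IsCompact K) : ∃ C : ℝ≥0∞, C ≠ ∞ ∧ volume.restrict K ≤ C • gaussN a n := by
  obtain ⟨M, hM⟩ := hK.exists_bound_of_continuousOn (contDiff_quad a n).continuous.continuousOn
  set c : ℝ := gaussConst a n * Real.exp (-M) with hc
  have hc0 : 0 < c := mul_pos (gaussConst_pos ha n) (Real.exp_pos _)
  refine ⟨(ENNReal.ofReal c)⁻¹, ENNReal.inv_ne_top.2 (by simpa using hc0), Measure.le_iff.2 fun s hs => ?_⟩
  rw [Measure.restrict_apply hs, Measure.smul_apply, smul_eq_mul,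
    ← ENNReal.mul_le_iff_le_inv (by simpa using hc0) ENNReal.ofReal_ne_top]
  calc ENNReal.ofReal c * volume (s ∩ K)
      = ∫⁻ _ in s ∩ K, ENNReal.ofReal c := by simp
    _ ≤ ∫⁻ y in s ∩ K, ENNReal.ofReal (gaussConst a n * Real.exp (-quad a n y)) := by
        refine setLIntegral_mono' (hs.inter hK.measurableSet) fun y hy => ?_
        refine ENNReal.ofReal_le_ofReal (mul_le_mul_of_nonneg_left (Real.exp_le_exp.2 ?_)
          (gaussConst_pos ha n).le)
        have := (le_abs_self _).trans (hM y hy.2)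
        linarith
    _ ≤ gaussN a n s := by
        rw [gaussN_eq_withDensity ha, withDensity_apply _ hs]
        exact lintegral_mono_set Set.inter_subset_left

theorem locallyIntegrable_of_memLp_gaussN {a : ℕ → ℝ} (ha : ∀ i, 0 < a i) {n : ℕ} {p : ℝ}
    (hp : 1 ≤ p) {F : (Fin n → ℝ) → ℝ} (hF : MemLp F (ENNReal.ofReal p) (gaussN a n)) :
    LocallyIntegrable F volume := by
  refine locallyIntegrable_iff.2 fun K hK => ?_
  obtain ⟨C, hC, hle⟩ := exists_volume_restrict_le ha n hK
  have hi : Integrable F (gaussN a n) := hF.integrable (by simpa using hp)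
  exact hi.of_measure_le_smul hC hle

/-! ### Weak jets on `ℝⁿ` -/

/-- A family `H` of locally integrable functions such that `H (i :: I)` is the weak derivative of
`H I` in direction `i`, for `I` of length less than `m`. -/
structure IsJet (n m : ℕ) (H : List ℕ → (Fin n → ℝ) → ℝ) : Prop where
  locallyIntegrable : ∀ I : List ℕ, I.length ≤ m → LocallyIntegrable (H I) volume
  rel : ∀ (I : List ℕ) (i : ℕ), I.length < m → ∀ v : (Fin n → ℝ) → ℝ, ContDiff ℝ C∞ v →
    HasCompactSupport v → ∫ y, H (i :: I) y * v y = -∫ y, H I y * dirD n i v y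

theorem proj_e_of_le {n i : ℕ} (h : n ≤ i) : proj n (e i) = 0 := by
  ext j
  rw [proj_apply, e_apply, if_neg (by have := j.2; omega)]
  rfl

theorem dirD_of_le {n i : ℕ} (h : n ≤ i) (u : (Fin n → ℝ) → ℝ) : dirD n i u = fun _ => 0 := by
  ext y
  rw [dirD, proj_e_of_le h, map_zero]

theorem dirD_mul {n i : ℕ} {u v : (Fin n → ℝ) → ℝ} (hu : Differentiable ℝ u)
    (hv : Differentiable ℝ v) (y : Fin n → ℝ) :
    dirD n i (fun z => u z * v z) y = dirD n i u y * v y + u y * dirD n i v y := by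
  simp only [dirD]
  rw [fderiv_fun_mul (hu y) (hv y)]
  simp only [add_apply, smul_apply, smul_eq_mul]
  ring

theorem dirD_exp_quad {a : ℕ → ℝ} (n : ℕ) {i : ℕ} (hi : i < n) (y : Fin n → ℝ) :
    dirD n i (fun z => Real.exp (quad a n z)) y = y ⟨i, hi⟩ / a i ^ 2 * Real.exp (quad a n y) := by
  have h1 : HasFDerivAt (quad a n) (∑ j : Fin n, (2 * y j / (2 * a j ^ 2)) •
      (ContinuousLinearMap.proj j : (Fin n → ℝ) →L[ℝ] ℝ)) y := by
    unfold quad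
    refine HasFDerivAt.fun_sum fun j _ => ?_
    have h2 : HasFDerivAt (fun z : Fin n → ℝ => z j)
      (ContinuousLinearMap.proj j : (Fin n → ℝ) →L[ℝ] ℝ) y := hasFDerivAt_apply j y
    have h3 := (h2.pow 2).mul_const (2 * a j ^ 2)⁻¹
    simp only [← div_eq_mul_inv] at h3
    refine h3.congr_fderiv ?_
    ext z
    simp
    ring
  rw [dirD, h1.exp.fderiv]
  simp only [smul_apply, sum_apply, ContinuousLinearMap.proj_apply, proj_apply, e_apply, smul_eq_mul]
  rw [Finset.sum_eq_single ⟨i, hi⟩]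
  · simp only [if_true, mul_one]
    rw [mul_div_mul_left _ _ two_ne_zero]
    ring
  · intro j _ hj
    rw [if_neg, mul_zero]
    rintro rfl
    exact hj rfl
  · simp

open Classical in
/-- The jet on `ℝⁿ` obtained by averaging a family of functions on `ℓ²`. -/
def avgJet (a : ℕ → ℝ) (n : ℕ) (g : List ℕ → Ell2 → ℝ) (I : List ℕ) : (Fin n → ℝ) → ℝ :=
  if ∀ i ∈ I, i < n then avg a n (g I) else fun _ => 0

/-- The Gaussian relation is tested with `v` divided by the density: times the density, the Gaussian
adjoint of this function is just `-D_i v`. If an index is at least `n`, both sides vanish, which is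
why `avgJet` is zero there. -/
theorem isJet_avgJet {a : ℕ → ℝ} (ha : ∀ i, 0 < a i) (hs : Summable a) (h1 : ∑' i, a i < 1)
    {p : ℝ} (hp : 1 ≤ p) {m : ℕ} {f : Ell2 → ℝ} {g : List ℕ → Ell2 → ℝ}
    (hm : ∀ I, Measurable (g I)) (hg : ∀ I : List ℕ, I.length ≤ m → HasWeakDeriv a p I f (g I))
    (n : ℕ) : IsJet n m (avgJet a n g) where
  locallyIntegrable I hI := by
    have hP := isProbabilityMeasure_P a ha hs h1
    rw [avgJet]
    split_ifs with h
    · exact locallyIntegrable_of_memLp_gaussN ha hp (memLp_avg hP hp (hm I) (hg I hI).1 n)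
    · exact locallyIntegrable_zero
  rel I i hI v hv hc := by
    by_cases hi : i < n
    swap
    · rw [dirD_of_le (not_lt.1 hi), avgJet, if_neg (fun h => hi (h i (by simp)))]
      simp
    by_cases hIn : ∀ j ∈ I, j < n
    swap
    · rw [avgJet, avgJet, if_neg (fun h => hIn fun j hj => h j (by simp [hj])), if_neg hIn]
      simp
    rw [avgJet, avgJet, if_pos (by simpa [hi] using hIn), if_pos hIn]
    have hc0 := gaussConst_pos ha n
    have hq : ContDiff ℝ C∞ fun z => Real.exp (quad a n z) := (contDiff_quad a n).exp
    set u : (Fin n → ℝ) → ℝ := fun y => (gaussConst a n)⁻¹ * (v y * Real.exp (quad a n y)) with hu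
    have hud : ContDiff ℝ C∞ u := contDiff_const.mul (hv.mul hq)
    have huc : HasCompactSupport u := HasCompactSupport.mul_left hc.mul_right
    have key := integral_avg_weakDeriv ha hs h1 hp (hm I) (hm (i :: I)) (hg I hI.le)
      (hg (i :: I) (by simpa using hI)) hi hud huc
    rw [integral_gaussN ha, integral_gaussN ha] at key
    have hD : ∀ y, dirD n i u y = (gaussConst a n)⁻¹ * (dirD n i v y * Real.exp (quad a n y)
        + v y * (y ⟨i, hi⟩ / a i ^ 2 * Real.exp (quad a n y))) := fun y => by
      rw [← dirD_exp_quad n hi, ← dirD_mul (hv.differentiable (by simp)) (hq.differentiable (by simp))]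
      simp only [dirD, hu]
      rw [fderiv_const_mul ((hv.mul hq).differentiable (by simp) y)]
      rfl
    have e1 : ∀ y, gaussConst a n * Real.exp (-quad a n y) * (avg a n (g (i :: I)) y * u y)
        = avg a n (g (i :: I)) y * v y := fun y => by
      simp only [hu, Real.exp_neg]
      field_simp
    have e2 : ∀ y, gaussConst a n * Real.exp (-quad a n y) * (avg a n (g I) y *
        (-dirD n i u y + y ⟨i, hi⟩ / a i ^ 2 * u y)) = -(avg a n (g I) y * dirD n i v y) := fun y => by
      rw [hD]
      have := ha i
      simp only [hu, Real.exp_neg]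
      field_simp
      ring
    simp_rw [e1, e2] at key
    rw [key, integral_neg]

/-! ### Truncation of jets -/

/-- Iterated directional derivatives. -/
def dirDs (n : ℕ) (I : List ℕ) (u : (Fin n → ℝ) → ℝ) : (Fin n → ℝ) → ℝ := I.foldr (dirD n) u

theorem contDiff_dirDs {n : ℕ} {u : (Fin n → ℝ) → ℝ} (hu : ContDiff ℝ C∞ u) (I : List ℕ) :
    ContDiff ℝ C∞ (dirDs n I u) := by
  induction I with
  | nil => exact hu
  | cons i I ih => exact contDiff_dirD ih i

theorem hasCompactSupport_dirDs {n : ℕ} {u : (Fin n → ℝ) → ℝ} (hu : HasCompactSupport u)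
    (I : List ℕ) : HasCompactSupport (dirDs n I u) := by
  induction I with
  | nil => exact hu
  | cons i I ih => exact hasCompactSupport_dirD ih i

theorem dirD_zero (n i : ℕ) : dirD n i (fun _ => 0) = fun _ => 0 := by
  ext y
  simp [dirD]

theorem dirDs_of_exists_le {n : ℕ} {I : List ℕ} (h : ¬∀ i ∈ I, i < n) (u : (Fin n → ℝ) → ℝ) :
    dirDs n I u = fun _ => 0 := by
  induction I with
  | nil => simp at h
  | cons i I ih =>
    by_cases hi : i < n
    · have : dirDs n I u = fun _ => 0 := ih fun h' => h (by simpa [hi] using h')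
      rw [dirDs, List.foldr_cons]
      rw [dirDs] at this
      rw [this, dirD_zero]
    · exact dirD_of_le (not_lt.1 hi) _

theorem pds_comp_proj {n : ℕ} {u : (Fin n → ℝ) → ℝ} (hu : ContDiff ℝ C∞ u) (I : List ℕ) :
    pds I (fun x => u (proj n x)) = fun x => dirDs n I u (proj n x) := by
  induction I with
  | nil => rfl
  | cons i I ih =>
    change pd i (pds I fun x => u (proj n x)) = _
    rw [ih, pd_comp_proj ((contDiff_dirDs hu I).differentiable (by simp))]
    rfl

theorem dirDs_comp_smul {n : ℕ} {u : (Fin n → ℝ) → ℝ} (hu : ContDiff ℝ C∞ u) (c : ℝ) (I : List ℕ) :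
    dirDs n I (fun y => u (c • y)) = fun y => c ^ I.length * dirDs n I u (c • y) := by
  induction I with
  | nil => simp [dirDs]
  | cons i I ih =>
    change dirD n i (dirDs n I fun y => u (c • y)) = _
    rw [ih]
    ext y
    have hd : Differentiable ℝ (dirDs n I u) := (contDiff_dirDs hu I).differentiable (by simp)
    have h1 : HasFDerivAt (fun y : Fin n → ℝ => c • y) (c • ContinuousLinearMap.id ℝ (Fin n → ℝ)) y :=
      (hasFDerivAt_id y).const_smul c
    have h2 := (((hd (c • y)).hasFDerivAt.comp y h1).const_mul (c ^ I.length)).fderiv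
    rw [dirD]
    refine (congrArg (fun L => L (proj n (e i))) h2).trans ?_
    change _ = c ^ (I.length + 1) * fderiv ℝ (dirDs n I u) (c • y) (proj n (e i))
    simp [pow_succ]
    ring

/-- The ways to split a list into two complementary sublists. -/
def splits : List ℕ → List (List ℕ × List ℕ)
  | [] => [([], [])]
  | i :: I => (splits I).map (fun q => (i :: q.1, q.2)) ++ (splits I).map fun q => (q.1, i :: q.2)

theorem length_le_of_mem_splits {I : List ℕ} {q : List ℕ × List ℕ} (h : q ∈ splits I) :
    q.2.length ≤ I.length := by
  induction I generalizing q with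
  | nil => simp [splits] at h; simp [h]
  | cons i I ih =>
    simp only [splits, List.mem_append, List.mem_map] at h
    rcases h with ⟨r, hr, rfl⟩ | ⟨r, hr, rfl⟩
    · exact (ih hr).trans (by simp)
    · simpa using ih hr

/-- Exactly one split leaves the first sublist empty. So `H I` can be written as a sum over the same
splits as `prodJet` and subtracted term by term. -/
theorem sum_splits_ite (I : List ℕ) (G : List ℕ → ℝ) :
    ((splits I).map fun q => if q.1 = [] then G q.2 else 0).sum = G I := by
  induction I generalizing G with
  | nil => simp [splits]
  | cons i I ih =>
    have h := ih fun J => G (i :: J)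
    simp only [splits, List.map_append, List.map_map, Function.comp_def, List.sum_append]
    rw [h]
    simp

/-- The jet of the product of a smooth function with the base of a jet. -/
def prodJet (n : ℕ) (η : (Fin n → ℝ) → ℝ) (H : List ℕ → (Fin n → ℝ) → ℝ) (I : List ℕ)
    (y : Fin n → ℝ) : ℝ :=
  ((splits I).map fun q => dirDs n q.1 η y * H q.2 y).sum

theorem list_sum_induction {α β : Type*} {Q : (α → ℝ) → Prop} (h0 : Q fun _ => 0)
    (hadd : ∀ f g, Q f → Q g → Q fun x => f x + g x) (S : List β) (F : β → α → ℝ)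
    (hF : ∀ q ∈ S, Q (F q)) : Q fun x => (S.map fun q => F q x).sum := by
  induction S with
  | nil => simpa using h0
  | cons q S ih =>
    simp only [List.map_cons, List.sum_cons]
    exact hadd _ _ (hF q (by simp)) (ih fun r hr => hF r (by simp [hr]))

theorem locallyIntegrable_smooth_mul {n : ℕ} {F η : (Fin n → ℝ) → ℝ} (hF : LocallyIntegrable F volume)
    (hη : Continuous η) : LocallyIntegrable (fun y => η y * F y) volume := by
  refine locallyIntegrable_iff.2 fun K hK => ?_
  exact (hF.integrableOn_isCompact hK).continuousOn_mul hη.continuousOn hK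

theorem integrable_mul_of_hasCompactSupport {n : ℕ} {F v : (Fin n → ℝ) → ℝ}
    (hF : LocallyIntegrable F volume) (hv : Continuous v) (hc : HasCompactSupport v) :
    Integrable (fun y => F y * v y) volume :=
  hF.integrable_smul_right_of_hasCompactSupport hv hc

/-- The Leibniz rule, split by split: each split of `I` yields two of `i :: I`, according to which
factor receives the new derivative. For one split the claim is the relation for `H` tested with `v`
times the derivative of `η`. -/
theorem isJet_prodJet {n m : ℕ} {H : List ℕ → (Fin n → ℝ) → ℝ} (hH : IsJet n m H)
    {η : (Fin n → ℝ) → ℝ} (hη : ContDiff ℝ C∞ η) : IsJet n m (prodJet n η H) where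
  locallyIntegrable I hI :=
    list_sum_induction (Q := fun f => LocallyIntegrable f volume) locallyIntegrable_zero
      (fun _ _ h h' => h.add h') _ _ fun q hq => locallyIntegrable_smooth_mul
        (hH.locallyIntegrable _ ((length_le_of_mem_splits hq).trans hI))
        (contDiff_dirDs hη q.1).continuous
  rel I i hI v hv hc := by
    have hv' := contDiff_dirD hv i (n := n)
    have hc' := hasCompactSupport_dirD hc i
    set A : List ℕ × List ℕ → (Fin n → ℝ) → ℝ := fun q y =>
      dirDs n (i :: q.1) η y * H q.2 y + dirDs n q.1 η y * H (i :: q.2) y with hA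
    set B : List ℕ × List ℕ → (Fin n → ℝ) → ℝ := fun q y => dirDs n q.1 η y * H q.2 y with hB
    have hsum : ∀ y, prodJet n η H (i :: I) y = ((splits I).map fun q => A q y).sum := fun y => by
      rw [prodJet]
      simp only [splits, List.map_append, List.map_map, Function.comp_def, List.sum_append, hA,
        List.sum_map_add]
    have hlA : ∀ q : List ℕ × List ℕ, q.2.length < m → LocallyIntegrable (A q) volume := fun q hq =>
      (locallyIntegrable_smooth_mul (hH.locallyIntegrable _ hq.le)
        (contDiff_dirDs hη (i :: q.1)).continuous).add
      (locallyIntegrable_smooth_mul (hH.locallyIntegrable _ (by simpa using hq))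
        (contDiff_dirDs hη q.1).continuous)
    have hlB : ∀ q : List ℕ × List ℕ, q.2.length < m → LocallyIntegrable (B q) volume := fun q hq =>
      locallyIntegrable_smooth_mul (hH.locallyIntegrable _ hq.le) (contDiff_dirDs hη q.1).continuous
    have hone : ∀ q : List ℕ × List ℕ, q.2.length < m →
        ∫ y, A q y * v y = -∫ y, B q y * dirD n i v y := fun q hq => by
      have hD := contDiff_dirDs hη q.1
      have hr := hH.rel q.2 i hq (fun y => dirDs n q.1 η y * v y) (hD.mul hv) hc.mul_left
      have hd : ∀ y, dirD n i (fun z => dirDs n q.1 η z * v z) y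
          = dirDs n (i :: q.1) η y * v y + dirDs n q.1 η y * dirD n i v y := fun y =>
        dirD_mul (hD.differentiable (by simp)) (hv.differentiable (by simp)) y
      have i1 := integrable_mul_of_hasCompactSupport (hH.locallyIntegrable q.2 hq.le)
        ((contDiff_dirDs hη (i :: q.1)).continuous.mul hv.continuous) hc.mul_left
      have i2 := integrable_mul_of_hasCompactSupport (hH.locallyIntegrable q.2 hq.le)
        (hD.continuous.mul hv'.continuous) hc'.mul_left
      have i3 := integrable_mul_of_hasCompactSupport
        (hH.locallyIntegrable (i :: q.2) (by simpa using hq)) (hD.continuous.mul hv.continuous)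
        hc.mul_left
      simp only [Pi.mul_apply] at i1 i2 i3
      simp_rw [hd, mul_add] at hr
      rw [integral_add i1 i2] at hr
      have e1 : ∫ y, A q y * v y = (∫ y, H q.2 y * (dirDs n (i :: q.1) η y * v y))
          + ∫ y, H (i :: q.2) y * (dirDs n q.1 η y * v y) := by
        rw [← integral_add i1 i3]
        refine integral_congr_ae (Eventually.of_forall fun y => ?_)
        simp only [hA]
        ring
      have e2 : ∫ y, B q y * dirD n i v y = ∫ y, H q.2 y * (dirDs n q.1 η y * dirD n i v y) := by
        refine integral_congr_ae (Eventually.of_forall fun y => ?_)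
        simp only [hB]
        ring
      rw [e1, e2, hr]
      ring
    have key : ∀ S : List (List ℕ × List ℕ), (∀ q ∈ S, q.2.length < m) →
        ∫ y, (S.map fun q => A q y).sum * v y
          = -∫ y, (S.map fun q => B q y).sum * dirD n i v y := fun S => by
      induction S with
      | nil => intro _; simp
      | cons q S ih =>
        intro hS
        have hq := hS q (by simp)
        have hS' : ∀ r ∈ S, r.2.length < m := fun r hr => hS r (by simp [hr])
        have hlist : ∀ F : List ℕ × List ℕ → (Fin n → ℝ) → ℝ,
            (∀ r : List ℕ × List ℕ, r.2.length < m → LocallyIntegrable (F r) volume) →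
            LocallyIntegrable (fun y => (S.map fun r => F r y).sum) volume := fun F hF =>
          list_sum_induction (Q := fun f => LocallyIntegrable f volume) locallyIntegrable_zero
            (fun _ _ h h' => h.add h') S F fun r hr => hF r (hS' r hr)
        simp only [List.map_cons, List.sum_cons, add_mul]
        rw [integral_add (integrable_mul_of_hasCompactSupport (hlA q hq) hv.continuous hc)
            (integrable_mul_of_hasCompactSupport (hlist A hlA) hv.continuous hc),
          integral_add (integrable_mul_of_hasCompactSupport (hlB q hq) hv'.continuous hc')
            (integrable_mul_of_hasCompactSupport (hlist B hlB) hv'.continuous hc'),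
          hone q hq, ih hS', neg_add]
    simp_rw [hsum]
    exact key _ fun q hq => (length_le_of_mem_splits hq).trans_lt hI

/-- A fixed bump function on `ℝⁿ`. -/
def bump (n : ℕ) : ContDiffBump (0 : Fin n → ℝ) := ⟨1, 2, one_pos, one_lt_two⟩

/-- The bump function at scale `N + 1`. -/
def scaledBump (n N : ℕ) (y : Fin n → ℝ) : ℝ := bump n (((N : ℝ) + 1)⁻¹ • y)

theorem contDiff_scaledBump (n N : ℕ) : ContDiff ℝ C∞ (scaledBump n N) :=
  (bump n).contDiff.comp (contDiff_const_smul _)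

theorem hasCompactSupport_scaledBump (n N : ℕ) : HasCompactSupport (scaledBump n N) :=
  (bump n).hasCompactSupport.comp_smul (by positivity)

theorem dirDs_scaledBump (n N : ℕ) (I : List ℕ) (y : Fin n → ℝ) :
    dirDs n I (scaledBump n N) y
      = (((N : ℝ) + 1)⁻¹) ^ I.length * dirDs n I (bump n) (((N : ℝ) + 1)⁻¹ • y) :=
  congrFun (dirDs_comp_smul (bump n).contDiff _ I) y

theorem exists_bound_dirDs_bump (n : ℕ) (I : List ℕ) :
    ∃ C : ℝ, 0 ≤ C ∧ ∀ y, |dirDs n I (bump n) y| ≤ C := by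
  obtain ⟨C, hC⟩ := (contDiff_dirDs (bump n).contDiff I).continuous.bounded_above_of_compact_support
    (hasCompactSupport_dirDs (bump n).hasCompactSupport I)
  exact ⟨C, (norm_nonneg _).trans (hC 0), hC⟩

theorem tendsto_dirDs_scaledBump (n : ℕ) (I : List ℕ) (y : Fin n → ℝ) :
    Tendsto (fun N => dirDs n I (scaledBump n N) y) atTop (𝓝 (if I = [] then 1 else 0)) := by
  have hlim : Tendsto (fun N : ℕ => ((N : ℝ) + 1)⁻¹) atTop (𝓝 0) := by
    simpa [one_div] using tendsto_one_div_add_atTop_nhds_zero_nat (𝕜 := ℝ)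
  split_ifs with h
  · subst h
    have h1 : Tendsto (fun N : ℕ => bump n (((N : ℝ) + 1)⁻¹ • y)) atTop (𝓝 (bump n ((0 : ℝ) • y))) :=
      ((bump n).continuous.tendsto _).comp (hlim.smul_const y)
    rw [zero_smul, (bump n).one_of_mem_closedBall (by simp [bump])] at h1
    exact h1
  · obtain ⟨C, hC0, hC⟩ := exists_bound_dirDs_bump n I
    have h1 : Tendsto (fun N : ℕ => (((N : ℝ) + 1)⁻¹) ^ I.length * C) atTop (𝓝 0) := by
      have := (hlim.pow I.length).mul_const C
      rwa [zero_pow (by simpa using h), zero_mul] at this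
    refine squeeze_zero_norm (fun N => ?_) h1
    rw [dirDs_scaledBump, norm_mul, norm_pow, norm_inv, Real.norm_of_nonneg (by positivity)]
    exact mul_le_mul_of_nonneg_left (hC _) (by positivity)

theorem exists_bound_dirDs_scaledBump (n : ℕ) (I : List ℕ) :
    ∃ C : ℝ, 0 ≤ C ∧ ∀ N y, |dirDs n I (scaledBump n N) y| ≤ C := by
  obtain ⟨C, hC0, hC⟩ := exists_bound_dirDs_bump n I
  refine ⟨C, hC0, fun N y => ?_⟩
  rw [dirDs_scaledBump, abs_mul, abs_of_nonneg (by positivity)]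
  refine (mul_le_of_le_one_left (abs_nonneg _) (pow_le_one₀ (by positivity) ?_)).trans (hC _)
  exact inv_le_one_of_one_le₀ (by linarith [N.cast_nonneg (α := ℝ)])

/-- In each Leibniz term the derivative of the cut-off stays bounded in `N` and tends to `1` if its
order is zero, to `0` otherwise; dominated convergence applies termwise. -/
theorem tendsto_prodJet_scaledBump {n m : ℕ} {p : ℝ} (hp : 1 ≤ p) {μ : Measure (Fin n → ℝ)}
    {H : List ℕ → (Fin n → ℝ) → ℝ}
    (hH : ∀ I : List ℕ, I.length ≤ m → MemLp (H I) (ENNReal.ofReal p) μ) {I : List ℕ}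
    (hI : I.length ≤ m) :
    Tendsto (fun N => eLpNorm (fun y => prodJet n (scaledBump n N) H I y - H I y)
      (ENNReal.ofReal p) μ) atTop (𝓝 0) := by
  have hq1 : 1 ≤ ENNReal.ofReal p := by simpa using hp
  set D : ℕ → List ℕ × List ℕ → (Fin n → ℝ) → ℝ := fun N q y =>
    (dirDs n q.1 (scaledBump n N) y - if q.1 = [] then 1 else 0) * H q.2 y with hD
  have hdiff : ∀ N, (fun y => prodJet n (scaledBump n N) H I y - H I y)
      = fun y => ((splits I).map fun q => D N q y).sum := fun N => by
    ext y
    conv_lhs => rw [← sum_splits_ite I fun J => H J y]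
    rw [prodJet, sub_eq_iff_eq_add, ← List.sum_map_add]
    congr 2
    ext q
    simp only [hD, sub_mul, ite_mul, one_mul, zero_mul, sub_add_cancel]
  simp_rw [hdiff]
  have hDm : ∀ N (q : List ℕ × List ℕ), q.2.length ≤ m → AEStronglyMeasurable (D N q) μ :=
    fun N q hq => ((contDiff_dirDs (contDiff_scaledBump n N) q.1).continuous.sub
      continuous_const).aestronglyMeasurable.mul (hH q.2 hq).1
  have hone : ∀ q : List ℕ × List ℕ, q.2.length ≤ m →
      Tendsto (fun N => eLpNorm (D N q) (ENNReal.ofReal p) μ) atTop (𝓝 0) := fun q hq => by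
    obtain ⟨C, hC0, hC⟩ := exists_bound_dirDs_scaledBump n q.1
    refine tendsto_eLpNorm_zero_of_dominated hp (G := fun y => (C + 1) * ‖H q.2 y‖)
      (fun N => hDm N q hq) ((hH q.2 hq).norm.const_mul _)
      (fun N => Eventually.of_forall fun y => ?_) (Eventually.of_forall fun y => ?_)
    · rw [norm_mul]
      refine mul_le_mul_of_nonneg_right ((norm_sub_le _ _).trans (add_le_add (hC N y) ?_))
        (norm_nonneg _)
      split_ifs <;> simp
    · have := ((tendsto_dirDs_scaledBump n q.1 y).sub_const (if q.1 = [] then 1 else 0)).mul_const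
        (H q.2 y)
      simpa using this
  have key : ∀ S : List (List ℕ × List ℕ), (∀ q ∈ S, q.2.length ≤ m) →
      Tendsto (fun N => eLpNorm (fun y => (S.map fun q => D N q y).sum) (ENNReal.ofReal p) μ)
        atTop (𝓝 0) := fun S => by
    induction S with
    | nil => intro _; simp
    | cons q S ih =>
      intro hS
      have hS' : ∀ r ∈ S, r.2.length ≤ m := fun r hr => hS r (by simp [hr])
      have h1 := (hone q (hS q (by simp))).add (ih hS')
      rw [add_zero] at h1
      refine tendsto_of_tendsto_of_tendsto_of_le_of_le tendsto_const_nhds h1 (fun _ => zero_le)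
        fun N => ?_
      simp only [List.map_cons, List.sum_cons]
      refine eLpNorm_add_le (hDm N q (hS q (by simp))) ?_ hq1
      exact list_sum_induction (Q := fun f => AEStronglyMeasurable f μ)
        aestronglyMeasurable_const (fun _ _ h h' => h.add h') S _ fun r hr => hDm N r (hS' r hr)
  exact key _ fun q hq => (length_le_of_mem_splits hq).trans hI

theorem measurable_prodJet {n : ℕ} {η : (Fin n → ℝ) → ℝ} (hη : ContDiff ℝ C∞ η)
    {H : List ℕ → (Fin n → ℝ) → ℝ} (hH : ∀ I, Measurable (H I)) (I : List ℕ) :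
    Measurable (prodJet n η H I) :=
  list_sum_induction (Q := Measurable) measurable_const (fun _ _ h h' => h.add h') _ _
    fun q _ => (contDiff_dirDs hη q.1).continuous.measurable.mul (hH q.2)

theorem hasCompactSupport_prodJet {n : ℕ} {η : (Fin n → ℝ) → ℝ} (hη : HasCompactSupport η)
    (H : List ℕ → (Fin n → ℝ) → ℝ) (I : List ℕ) : HasCompactSupport (prodJet n η H I) :=
  list_sum_induction (Q := HasCompactSupport) HasCompactSupport.zero
    (fun _ _ h h' => HasCompactSupport.add h h') _ _
    fun q _ => (hasCompactSupport_dirDs hη q.1).mul_right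

theorem memLp_prodJet {n m : ℕ} {p : ℝ} {μ : Measure (Fin n → ℝ)} {η : (Fin n → ℝ) → ℝ}
    (hη : ContDiff ℝ C∞ η) (hc : HasCompactSupport η) {H : List ℕ → (Fin n → ℝ) → ℝ}
    (hH : ∀ I : List ℕ, I.length ≤ m → MemLp (H I) (ENNReal.ofReal p) μ) {I : List ℕ}
    (hI : I.length ≤ m) : MemLp (prodJet n η H I) (ENNReal.ofReal p) μ := by
  refine list_sum_induction (Q := fun f => MemLp f (ENNReal.ofReal p) μ) MemLp.zero
    (fun _ _ h h' => h.add h') _ _ fun q hq => ?_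
  have hD := (contDiff_dirDs hη q.1).continuous
  obtain ⟨C, hC⟩ := hD.bounded_above_of_compact_support (hasCompactSupport_dirDs hc q.1)
  have h2 := hH q.2 ((length_le_of_mem_splits hq).trans hI)
  exact (h2.norm.const_mul C).mono (hD.aestronglyMeasurable.mul h2.1)
    (Eventually.of_forall fun y => by
      rw [norm_mul]
      exact (mul_le_mul_of_nonneg_right (hC y) (norm_nonneg _)).trans (Real.le_norm_self _))

theorem memLp_volume_of_hasCompactSupport {a : ℕ → ℝ} (ha : ∀ i, 0 < a i) {n : ℕ} {p : ℝ}
    {F : (Fin n → ℝ) → ℝ} (hF : MemLp F (ENNReal.ofReal p) (gaussN a n))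
    (hc : HasCompactSupport F) : MemLp F (ENNReal.ofReal p) volume := by
  obtain ⟨C, hC, hle⟩ := exists_volume_restrict_le ha n hc
  have h1 := hF.of_measure_le_smul hC hle
  have hmeas : MeasurableSet (tsupport F) := (isClosed_tsupport F).measurableSet
  rwa [← memLp_indicator_iff_restrict hmeas,
    Set.indicator_eq_self.2 (subset_tsupport F)] at h1

/-! ### Mollification of jets -/

open scoped Convolution

/-- Mollification of a function on `ℝⁿ`. -/
def moll {n : ℕ} (φ : ContDiffBump (0 : Fin n → ℝ)) (F : (Fin n → ℝ) → ℝ) : (Fin n → ℝ) → ℝ :=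
  φ.normed volume ⋆[ContinuousLinearMap.lsmul ℝ ℝ, volume] F

theorem contDiff_moll {n : ℕ} (φ : ContDiffBump (0 : Fin n → ℝ)) {F : (Fin n → ℝ) → ℝ}
    (hF : LocallyIntegrable F volume) : ContDiff ℝ C∞ (moll φ F) :=
  φ.hasCompactSupport_normed.contDiff_convolution_left _ φ.contDiff_normed hF

theorem hasCompactSupport_moll {n : ℕ} (φ : ContDiffBump (0 : Fin n → ℝ)) {F : (Fin n → ℝ) → ℝ}
    (hF : HasCompactSupport F) : HasCompactSupport (moll φ F) :=
  φ.hasCompactSupport_normed.convolution _ hF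

theorem dirD_moll {n : ℕ} (φ : ContDiffBump (0 : Fin n → ℝ)) {F : (Fin n → ℝ) → ℝ}
    (hF : LocallyIntegrable F volume) (i : ℕ) (x : Fin n → ℝ) :
    dirD n i (moll φ F) x = ∫ t, F t * dirD n i (φ.normed volume) (x - t) := by
  have hφ : ContDiff ℝ 1 (φ.normed (volume : Measure (Fin n → ℝ))) := φ.contDiff_normed
  have h := φ.hasCompactSupport_normed.hasFDerivAt_convolution_left
    (ContinuousLinearMap.lsmul ℝ ℝ) hφ hF x
  have hex := ((φ.hasCompactSupport_normed (μ := volume)).fderiv ℝ).convolutionExists_left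
    ((ContinuousLinearMap.lsmul ℝ ℝ).precompL (Fin n → ℝ)) (hφ.continuous_fderiv one_ne_zero) hF x
  rw [dirD, moll, h.fderiv, convolution_eq_swap, ContinuousLinearMap.integral_apply]
  · refine integral_congr_ae (Eventually.of_forall fun t => ?_)
    simp [dirD, mul_comm]
  · exact hex.integrable_swap

theorem dirD_comp_sub {n : ℕ} {u : (Fin n → ℝ) → ℝ} (hu : Differentiable ℝ u) (i : ℕ)
    (x t : Fin n → ℝ) : dirD n i (fun s => u (x - s)) t = -dirD n i u (x - t) := by
  have h := (hu (x - t)).hasFDerivAt.comp t ((hasFDerivAt_id t).const_sub x)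
  have h2 : fderiv ℝ (fun s => u (x - s)) t = _ := h.fderiv
  rw [dirD, h2]
  simp [dirD]

/-- A derivative of the mollification falls on the kernel. The reflected kernel `t ↦ φ (x - t)` is
an admissible test function, and the sign from the reflection cancels the one from integration by
parts. -/
theorem dirDs_moll {n m : ℕ} {H : List ℕ → (Fin n → ℝ) → ℝ} (hH : IsJet n m H)
    (φ : ContDiffBump (0 : Fin n → ℝ)) {I : List ℕ} (hI : I.length ≤ m) :
    dirDs n I (moll φ (H [])) = moll φ (H I) := by
  induction I with
  | nil => rfl
  | cons i I ih =>
    change dirD n i (dirDs n I (moll φ (H []))) = _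
    have hI' : I.length < m := by simpa using hI
    rw [ih hI'.le]
    ext x
    have hφ : ContDiff ℝ C∞ (φ.normed (volume : Measure (Fin n → ℝ))) := φ.contDiff_normed
    have h := hH.rel I i hI' (fun t => φ.normed volume (x - t))
      (hφ.comp (contDiff_const.sub contDiff_id))
      (φ.hasCompactSupport_normed.comp_homeomorph (Homeomorph.subLeft x))
    rw [dirD_moll φ (hH.locallyIntegrable I hI'.le), moll, convolution_lsmul_swap]
    simp_rw [dirD_comp_sub (hφ.differentiable (by simp)), mul_neg, integral_neg, neg_neg] at h
    rw [← h]
    simp_rw [smul_eq_mul, mul_comm]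

/-- Mollification averages translates against the probability measure with density `φ.normed`, and
Lebesgue measure is translation invariant. -/
theorem eLpNorm_moll_le {n : ℕ} (φ : ContDiffBump (0 : Fin n → ℝ)) {p : ℝ} (hp : 1 ≤ p)
    {F : (Fin n → ℝ) → ℝ} (hF : Measurable F) :
    eLpNorm (moll φ F) (ENNReal.ofReal p) volume ≤ eLpNorm F (ENNReal.ofReal p) volume := by
  set w : (Fin n → ℝ) → ℝ≥0∞ := fun t => ENNReal.ofReal (φ.normed volume t) with hw
  have hwm : Measurable w := φ.continuous_normed.measurable.ennreal_ofReal
  set ν : Measure (Fin n → ℝ) := volume.withDensity w with hν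
  have hprob : IsProbabilityMeasure ν := by
    constructor
    rw [hν, withDensity_apply _ MeasurableSet.univ, Measure.restrict_univ,
      ← ofReal_integral_eq_lintegral_ofReal φ.integrable_normed
        (Eventually.of_forall φ.nonneg_normed), φ.integral_normed, ENNReal.ofReal_one]
  have hmeas : Measurable fun q : (Fin n → ℝ) × (Fin n → ℝ) => F (q.1 - q.2) :=
    hF.comp (measurable_fst.sub measurable_snd)
  have h1 : moll φ F = fun x => ∫ t, F (x - t) ∂ν := by
    ext x
    rw [moll, convolution_lsmul, hν, integral_withDensity_eq_integral_toReal_smul hwm (by simp [hw])]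
    refine integral_congr_ae (Eventually.of_forall fun t => ?_)
    simp only [hw]
    rw [ENNReal.toReal_ofReal (φ.nonneg_normed t)]
  rw [h1]
  refine (eLpNorm_integral_le hp hmeas).trans_eq ?_
  rw [eLpNorm_ofReal_eq hp, eLpNorm_ofReal_eq hp, lintegral_prod_symm _ (by fun_prop)]
  congr 1
  have h2 : ∀ t : Fin n → ℝ, ∫⁻ x, ‖F (x - t)‖ₑ ^ p = ∫⁻ x, ‖F x‖ₑ ^ p := fun t =>
    lintegral_sub_right_eq_self (fun x => ‖F x‖ₑ ^ p) t
  simp [h2]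

/-- A sequence of bump functions concentrating at the origin. -/
def bumpSeq (n k : ℕ) : ContDiffBump (0 : Fin n → ℝ) where
  rIn := ((k : ℝ) + 1)⁻¹ / 2
  rOut := ((k : ℝ) + 1)⁻¹
  rIn_pos := by positivity
  rIn_lt_rOut := half_lt_self (by positivity)

/-- The Gaussian norm is at most a constant times the Lebesgue norm, in which mollification is a
contraction and `F` is close to some continuous `b` with compact support. Uniform continuity makes
the mollification of `b` uniformly close to `b`, and total mass `1` turns this into an `L^p` bound.
-/
theorem tendsto_moll_sub {a : ℕ → ℝ} (ha : ∀ i, 0 < a i) {n : ℕ} {p : ℝ} (hp : 1 ≤ p)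
    {F : (Fin n → ℝ) → ℝ} (hF : Measurable F) (hL : MemLp F (ENNReal.ofReal p) volume) :
    Tendsto (fun k => eLpNorm (fun y => moll (bumpSeq n k) F y - F y) (ENNReal.ofReal p)
      (gaussN a n)) atTop (𝓝 0) := by
  have hq1 : 1 ≤ ENNReal.ofReal p := by simpa using hp
  set K : ℝ≥0∞ := ENNReal.ofReal (gaussConst a n) ^ (1 / ENNReal.ofReal p).toReal with hK
  have hKt : K ≠ ∞ := ENNReal.rpow_ne_top_of_nonneg ENNReal.toReal_nonneg ENNReal.ofReal_ne_top
  have hcomp : ∀ f : (Fin n → ℝ) → ℝ, eLpNorm f (ENNReal.ofReal p) (gaussN a n)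
      ≤ K * eLpNorm f (ENNReal.ofReal p) volume := fun f =>
    eLpNorm_le_of_measure_le_smul (gaussN_le_smul_volume ha n)
  rw [ENNReal.tendsto_nhds_zero]
  intro ε hε
  have hε3 : ε / 3 ≠ 0 := by simp [hε.ne']
  obtain ⟨δ, hδ0, hδ⟩ : ∃ δ : ℝ≥0∞, δ ≠ 0 ∧ K * δ ≤ ε / 3 := by
    -- Dividing by `K + 1` rather than `K` avoids a separate argument for a nonzero divisor.
    refine ⟨ε / 3 / (K + 1), ENNReal.div_ne_zero.2 ⟨hε3, by simp [hKt]⟩, ?_⟩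
    rw [← mul_div_assoc]
    refine ENNReal.div_le_of_le_mul ?_
    rw [mul_comm]
    gcongr
    exact le_self_add
  obtain ⟨b, hbc, hb, hbcont, hbL⟩ :=
    hL.exists_hasCompactSupport_eLpNorm_sub_le ENNReal.ofReal_ne_top hδ0
  obtain ⟨r, hr0, hr⟩ : ∃ r : ℝ, 0 < r ∧ ENNReal.ofReal r ≤ ε / 3 := by
    by_cases h : ε / 3 = ∞
    · exact ⟨1, one_pos, by simp [h]⟩
    · exact ⟨(ε / 3).toReal, ENNReal.toReal_pos hε3 h, ENNReal.ofReal_toReal_le⟩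
  obtain ⟨s, hs0, hs⟩ := Metric.uniformContinuous_iff.1
    (hbc.uniformContinuous_of_continuous hbcont) r hr0
  have hlim : Tendsto (fun k : ℕ => ((k : ℝ) + 1)⁻¹) atTop (𝓝 0) := by
    simpa [one_div] using tendsto_one_div_add_atTop_nhds_zero_nat (𝕜 := ℝ)
  filter_upwards [hlim.eventually_lt_const hs0] with k hk
  have hbl : LocallyIntegrable b volume := hbcont.locallyIntegrable
  have hFl : LocallyIntegrable F volume := hL.locallyIntegrable hq1
  have hlin : moll (bumpSeq n k) F = moll (bumpSeq n k) (F - b) + moll (bumpSeq n k) b := by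
    have hex : ∀ G : (Fin n → ℝ) → ℝ, LocallyIntegrable G volume →
        ConvolutionExists ((bumpSeq n k).normed volume) G (ContinuousLinearMap.lsmul ℝ ℝ) volume :=
      fun G hG => (bumpSeq n k).hasCompactSupport_normed.convolutionExists_left _
        (bumpSeq n k).continuous_normed hG
    ext x
    have := (hex _ (hFl.sub hbl) x).distrib_add (hex _ hbl x)
    rw [sub_add_cancel] at this
    exact this
  have hdec : (fun y => moll (bumpSeq n k) F y - F y)
      = moll (bumpSeq n k) (F - b) + ((fun y => moll (bumpSeq n k) b y - b y) - (F - b)) := by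
    ext y
    simp only [hlin, Pi.add_apply, Pi.sub_apply]
    ring
  have m1 : AEStronglyMeasurable (moll (bumpSeq n k) (F - b)) (gaussN a n) :=
    (contDiff_moll _ (hFl.sub hbl)).continuous.aestronglyMeasurable
  have m2 : AEStronglyMeasurable (fun y => moll (bumpSeq n k) b y - b y) (gaussN a n) :=
    ((contDiff_moll _ hbl).continuous.sub hbcont).aestronglyMeasurable
  have m3 : AEStronglyMeasurable (F - b) (gaussN a n) :=
    (hF.sub hbcont.measurable).aestronglyMeasurable
  rw [hdec]
  calc _ ≤ ε / 3 + (ε / 3 + ε / 3) := by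
        refine (eLpNorm_add_le m1 (m2.sub m3) hq1).trans (add_le_add ?_
          ((eLpNorm_sub_le m2 m3 hq1).trans (add_le_add ?_ ?_)))
        · refine (hcomp _).trans (le_trans ?_ hδ)
          gcongr
          exact (eLpNorm_moll_le _ hp (hF.sub hbcont.measurable)).trans hb
        · refine (eLpNorm_le_of_ae_bound (C := r) (Eventually.of_forall fun y => ?_)).trans ?_
          · rw [← dist_eq_norm]
            refine ContDiffBump.dist_normed_convolution_le hbcont.aestronglyMeasurable
              fun z hz => (hs ?_).le
            exact (Metric.mem_ball.1 hz).trans hk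
          · simpa using hr
        · refine (hcomp _).trans (le_trans ?_ hδ)
          gcongr
    _ = ε := by rw [← add_assoc]; exact ENNReal.add_thirds ε

/-! ### Simultaneous smooth approximation of a jet on `ℝⁿ` -/

theorem finite_lists_lt (n m : ℕ) : {I : List ℕ | (∀ i ∈ I, i < n) ∧ I.length ≤ m}.Finite := by
  refine ((List.finite_length_le (Fin n) m).image (List.map Fin.val)).subset fun I hI => ?_
  refine ⟨I.pmap Fin.mk hI.1, by simpa using hI.2, ?_⟩
  rw [List.map_pmap]
  simp

/-- Truncation comes first, because compact support brings the jet into Lebesgue `L^p`, where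
mollification works. Only finitely many lists have all indices below `n`, so one `N` and one `k`
serve them all; for the other lists both functions vanish. -/
theorem exists_smooth_approx_jet {a : ℕ → ℝ} (ha : ∀ i, 0 < a i) {n m : ℕ} {p : ℝ} (hp : 1 ≤ p)
    {H : List ℕ → (Fin n → ℝ) → ℝ} (hH : IsJet n m H) (hm : ∀ I, Measurable (H I))
    (hL : ∀ I : List ℕ, I.length ≤ m → MemLp (H I) (ENNReal.ofReal p) (gaussN a n))
    (h0 : ∀ I : List ℕ, (¬∀ i ∈ I, i < n) → H I = fun _ => 0) {ε : ℝ≥0∞} (hε : 0 < ε) :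
    ∃ u : (Fin n → ℝ) → ℝ, ContDiff ℝ C∞ u ∧ HasCompactSupport u ∧
      ∀ I : List ℕ, I.length ≤ m →
        eLpNorm (fun y => dirDs n I u y - H I y) (ENNReal.ofReal p) (gaussN a n) ≤ ε := by
  have hq1 : 1 ≤ ENNReal.ofReal p := by simpa using hp
  have hε2 : 0 < ε / 2 := ENNReal.half_pos hε.ne'
  have hfin := finite_lists_lt n m
  obtain ⟨N, hN⟩ := ((hfin.eventually_all (l := atTop)).2 fun I hI =>
    (ENNReal.tendsto_nhds_zero.1 (tendsto_prodJet_scaledBump hp hL hI.2)) (ε / 2) hε2).exists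
  have hη := contDiff_scaledBump n N
  have hηc := hasCompactSupport_scaledBump n N
  set G := prodJet n (scaledBump n N) H with hG
  have hGj : IsJet n m G := isJet_prodJet hH hη
  obtain ⟨k, hk⟩ := ((hfin.eventually_all (l := atTop)).2 fun I hI =>
    (ENNReal.tendsto_nhds_zero.1 (tendsto_moll_sub ha hp (measurable_prodJet hη hm I)
      (memLp_volume_of_hasCompactSupport ha (memLp_prodJet hη hηc hL hI.2)
        (hasCompactSupport_prodJet hηc H I)))) (ε / 2) hε2).exists
  have hu := contDiff_moll (bumpSeq n k) (hGj.locallyIntegrable [] (by simp))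
  refine ⟨moll (bumpSeq n k) (G []), hu,
    hasCompactSupport_moll _ (hasCompactSupport_prodJet hηc H []), fun I hI => ?_⟩
  by_cases hIn : ∀ i ∈ I, i < n
  swap
  · rw [h0 I hIn, dirDs_of_exists_le hIn]
    simp
  have h1 := hk I ⟨hIn, hI⟩
  have h2 := hN I ⟨hIn, hI⟩
  rw [dirDs_moll hGj _ hI]
  have hdec : (fun y => moll (bumpSeq n k) (G I) y - H I y)
      = (fun y => moll (bumpSeq n k) (G I) y - G I y) + fun y => G I y - H I y := by
    ext y
    simp
  have hGm : Measurable (G I) := measurable_prodJet hη hm I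
  rw [hdec]
  refine (eLpNorm_add_le ?_ (hGm.sub (hm I)).aestronglyMeasurable hq1).trans ?_
  · exact (contDiff_moll _ (hGj.locallyIntegrable I hI)).continuous.aestronglyMeasurable.sub
      hGm.aestronglyMeasurable
  · exact (add_le_add h1 h2).trans_eq (ENNReal.add_halves ε)

/-! ### Density of smooth cylinder functions -/

theorem lintegral_enorm_rpow_eq {α : Type*} [MeasurableSpace α] {p : ℝ} (hp : 1 ≤ p) (f : α → ℝ)
    (μ : Measure α) : ∫⁻ x, ‖f x‖ₑ ^ p ∂μ = eLpNorm f (ENNReal.ofReal p) μ ^ p := by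
  rw [eLpNorm_ofReal_eq hp, ← ENNReal.rpow_mul, one_div_mul_cancel (by linarith), ENNReal.rpow_one]

theorem tendsto_tsum_zero_of_dominated {β : Type*} [Countable β] {F : ℕ → β → ℝ≥0∞} {G : β → ℝ≥0∞}
    (hG : ∑' b, G b ≠ ∞) (hle : ∀ n b, F n b ≤ G b)
    (hlim : ∀ b, Tendsto (fun n => F n b) atTop (𝓝 0)) :
    Tendsto (fun n => ∑' b, F n b) atTop (𝓝 0) := by
  let _ : MeasurableSpace β := ⊤
  have h := tendsto_lintegral_of_dominated_convergence (μ := Measure.count) (F := F)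
    (f := fun _ => 0) G (fun _ => Measurable.of_discrete)
    (fun n => Eventually.of_forall (hle n)) (by rwa [lintegral_count]) (Eventually.of_forall hlim)
  simpa [lintegral_count] using h

theorem measurable_avgJet {a : ℕ → ℝ} (hP : IsProbabilityMeasure (P a)) {g : List ℕ → Ell2 → ℝ}
    (hg : ∀ I, Measurable (g I)) (n : ℕ) (I : List ℕ) : Measurable (avgJet a n g I) := by
  rw [avgJet]
  split_ifs
  exacts [measurable_avg hP (hg I) n, measurable_const]

theorem memLp_avgJet {a : ℕ → ℝ} (hP : IsProbabilityMeasure (P a)) {p : ℝ} (hp : 1 ≤ p)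
    {g : List ℕ → Ell2 → ℝ} {I : List ℕ} (hg : Measurable (g I))
    (hL : MemLp (g I) (ENNReal.ofReal p) (P a)) (n : ℕ) :
    MemLp (avgJet a n g I) (ENNReal.ofReal p) (gaussN a n) := by
  rw [avgJet]
  split_ifs
  exacts [memLp_avg hP hp hg hL n, MemLp.zero]

theorem eLpNorm_avgJet_sub_le {a : ℕ → ℝ} (hP : IsProbabilityMeasure (P a)) {p : ℝ} (hp : 1 ≤ p)
    {g : List ℕ → Ell2 → ℝ} {I : List ℕ} (hg : Measurable (g I)) (n : ℕ) :
    eLpNorm (fun x => avgJet a n g I (proj n x) - g I x) (ENNReal.ofReal p) (P a)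
      ≤ 2 * eLpNorm (g I) (ENNReal.ofReal p) (P a) := by
  rw [avgJet]
  split_ifs
  · have hm := (measurable_avg hP hg n).aestronglyMeasurable (μ := gaussN a n)
    have h1 := eLpNorm_comp_measurePreserving (p := ENNReal.ofReal p) hm (measurePreserving_proj hP n)
    refine (eLpNorm_sub_le (hm.comp_measurePreserving (measurePreserving_proj hP n))
      hg.aestronglyMeasurable (by simpa using hp)).trans ?_
    rw [h1, two_mul]
    exact add_le_add (eLpNorm_avg_le hP hp hg n) le_rfl
  · have : (fun x => 0 - g I x) = -g I := by ext; simp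
    rw [this, eLpNorm_neg, two_mul]
    exact le_self_add

theorem tendsto_eLpNorm_avgJet_sub {a : ℕ → ℝ} (hP : IsProbabilityMeasure (P a)) {p : ℝ}
    (hp : 1 ≤ p) {g : List ℕ → Ell2 → ℝ} {I : List ℕ} (hg : Measurable (g I))
    (hL : MemLp (g I) (ENNReal.ofReal p) (P a)) :
    Tendsto (fun n => eLpNorm (fun x => avgJet a n g I (proj n x) - g I x) (ENNReal.ofReal p) (P a))
      atTop (𝓝 0) := by
  refine (tendsto_eLpNorm_avg_sub hP hp hg hL).congr' ?_
  -- Once `n` exceeds every index in `I`, the zero default of `avgJet` no longer occurs.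
  filter_upwards [eventually_gt_atTop (I.foldr max 0)] with n hn
  rw [avgJet, if_pos fun i hi => lt_of_le_of_lt (List.le_max_of_le' 0 hi le_rfl) hn]

/-- The part of order `k` of the energy of a family of functions. -/
def jetEnergy (a : ℕ → ℝ) (p : ℝ) (k : ℕ) (h : List ℕ → Ell2 → ℝ) : ℝ≥0∞ :=
  ∑' I : Fin k → ℕ, (∏ j, ENNReal.ofReal (a (I j) ^ p)) * ∫⁻ x, ‖h (List.ofFn I) x‖ₑ ^ p ∂(P a)

theorem jetEnergy_zero (a : ℕ → ℝ) (p : ℝ) (h : List ℕ → Ell2 → ℝ) :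
    jetEnergy a p 0 h = ∫⁻ x, ‖h [] x‖ₑ ^ p ∂(P a) := by
  rw [jetEnergy, tsum_fintype, Fintype.sum_unique]
  simp

/-- By uniqueness any representatives may be used in the norm. The empty list carries the function
itself, so order zero is treated like all others. -/
theorem lintegral_add_derivEnergy {a : ℕ → ℝ} (ha : ∀ i, 0 < a i) (hs : Summable a)
    (h1 : ∑' i, a i < 1) {m : ℕ} {p : ℝ} (hp : 1 ≤ p) {f : Ell2 → ℝ} {h : List ℕ → Ell2 → ℝ}
    (hh : ∀ I : List ℕ, I.length ≤ m → HasWeakDeriv a p I f (h I)) (h0 : h [] =ᵐ[P a] f) :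
    (∫⁻ x, ‖f x‖ₑ ^ p ∂(P a)) + derivEnergy a m p f
      = ∑ k ∈ Finset.range (m + 1), jetEnergy a p k h := by
  rw [Finset.sum_range_succ', jetEnergy_zero, add_comm, derivEnergy]
  congr 1
  · rw [Finset.sum_bij' (fun k _ => k - 1) (fun k _ => k + 1)]
    · intro k hk; simp at hk ⊢; omega
    · intro k hk; simp at hk ⊢; omega
    · intro k hk; simp at hk ⊢; omega
    · intro k hk; simp
    · intro k hk
      rw [Finset.mem_Icc] at hk
      rw [Nat.sub_add_cancel hk.1]
      refine tsum_congr fun I => ?_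
      congr 1
      refine lintegral_congr_ae ?_
      filter_upwards [(hh (List.ofFn I) (by simpa using hk.2)).weakDeriv_ae_eq ha hs h1 hp] with x hx
      rw [hx]
  · refine lintegral_congr_ae ?_
    filter_upwards [h0] with x hx
    rw [hx]

/-- The error `ε` is the same for all multi-indices, so its weighted sum factors into a power of `∑
a_i^p`. The factor `2 ^ (p - 1)` comes from convexity of `t ↦ t^p`. -/
theorem jetEnergy_le {a : ℕ → ℝ} (hP : IsProbabilityMeasure (P a)) {m : ℕ} {p : ℝ} (hp : 1 ≤ p)
    {n : ℕ} {g : List ℕ → Ell2 → ℝ} (hg : ∀ I, Measurable (g I)) {u : (Fin n → ℝ) → ℝ}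
    (hu : ContDiff ℝ C∞ u) {ε : ℝ≥0∞}
    (hε : ∀ I : List ℕ, I.length ≤ m → eLpNorm (fun y => dirDs n I u y - avgJet a n g I y)
      (ENNReal.ofReal p) (gaussN a n) ≤ ε) {k : ℕ} (hk : k ≤ m) :
    jetEnergy a p k (fun I x => dirDs n I u (proj n x) - g I x) ≤ 2 ^ (p - 1) *
      (ε ^ p * (∑' i, ENNReal.ofReal (a i ^ p)) ^ k
        + jetEnergy a p k fun I x => avgJet a n g I (proj n x) - g I x) := by
  rw [← ENNReal_tsum_prod_eq_pow, jetEnergy, jetEnergy, ← ENNReal.tsum_mul_left, ← ENNReal.tsum_add,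
    ← ENNReal.tsum_mul_left]
  refine ENNReal.tsum_le_tsum fun I => ?_
  set J := List.ofFn I
  have hm1 : Measurable fun y => dirDs n J u y - avgJet a n g J y :=
    (contDiff_dirDs hu J).continuous.measurable.sub (measurable_avgJet hP hg n J)
  have hpm := (proj n).continuous.measurable
  have hdec : (fun x => dirDs n J u (proj n x) - g J x)
      = ((fun y => dirDs n J u y - avgJet a n g J y) ∘ proj n)
        + fun x => avgJet a n g J (proj n x) - g J x := by
    ext x
    simp
  have key : ∫⁻ x, ‖dirDs n J u (proj n x) - g J x‖ₑ ^ p ∂(P a) ≤ 2 ^ (p - 1) *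
      (ε ^ p + ∫⁻ x, ‖avgJet a n g J (proj n x) - g J x‖ₑ ^ p ∂(P a)) := by
    rw [lintegral_enorm_rpow_eq hp, lintegral_enorm_rpow_eq hp, hdec]
    refine (ENNReal.rpow_le_rpow (eLpNorm_add_le (hm1.comp hpm).aestronglyMeasurable
      (((measurable_avgJet hP hg n J).comp hpm).sub (hg J)).aestronglyMeasurable
      (by simpa using hp)) (by linarith)).trans ?_
    refine (ENNReal.rpow_add_le_mul_rpow_add_rpow _ _ hp).trans ?_
    refine mul_le_mul_right (add_le_add (ENNReal.rpow_le_rpow ?_ (by linarith)) le_rfl) _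
    rw [eLpNorm_comp_measurePreserving hm1.aestronglyMeasurable (measurePreserving_proj hP n)]
    exact hε J (by simpa [J] using hk)
  calc _ ≤ (∏ j, ENNReal.ofReal (a (I j) ^ p)) * (2 ^ (p - 1) *
      (ε ^ p + ∫⁻ x, ‖avgJet a n g J (proj n x) - g J x‖ₑ ^ p ∂(P a))) := by gcongr
    _ = _ := by ring

/-- Each term tends to zero, and `2 ^ p` times the finite energy of `g` is a majorant uniform in
`n`, also where `avgJet` is zero by default. -/
theorem tendsto_jetEnergy_avgJet_sub {a : ℕ → ℝ} (hP : IsProbabilityMeasure (P a)) {p : ℝ}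
    (hp : 1 ≤ p) {g : List ℕ → Ell2 → ℝ} (hg : ∀ I, Measurable (g I)) {k : ℕ}
    (hL : ∀ I : List ℕ, I.length = k → MemLp (g I) (ENNReal.ofReal p) (P a))
    (hfin : jetEnergy a p k g < ∞) :
    Tendsto (fun n => jetEnergy a p k fun I x => avgJet a n g I (proj n x) - g I x) atTop (𝓝 0) := by
  have hp0 : 0 < p := by linarith
  refine tendsto_tsum_zero_of_dominated (G := fun I : Fin k → ℕ => 2 ^ p *
    ((∏ j, ENNReal.ofReal (a (I j) ^ p)) * ∫⁻ x, ‖g (List.ofFn I) x‖ₑ ^ p ∂(P a))) ?_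
    (fun n I => ?_) fun I => ?_
  · rw [ENNReal.tsum_mul_left]
    exact (ENNReal.mul_lt_top (ENNReal.rpow_lt_top_of_nonneg hp0.le (by simp)) hfin).ne
  · rw [mul_left_comm]
    gcongr
    rw [lintegral_enorm_rpow_eq hp, lintegral_enorm_rpow_eq hp, ← ENNReal.mul_rpow_of_nonneg _ _ hp0.le]
    exact ENNReal.rpow_le_rpow (eLpNorm_avgJet_sub_le hP hp (hg _) n) hp0.le
  · have h1 := (tendsto_eLpNorm_avgJet_sub hP hp (hg (List.ofFn I))
      (hL (List.ofFn I) (by simp))).ennrpow_const p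
    rw [ENNReal.zero_rpow_of_pos hp0] at h1
    simp_rw [← lintegral_enorm_rpow_eq hp] at h1
    have h2 := ENNReal.Tendsto.const_mul (a := ∏ j, ENNReal.ofReal (a (I j) ^ p)) h1
      (Or.inr (ENNReal.prod_ne_top fun _ _ => ENNReal.ofReal_ne_top))
    rwa [mul_zero] at h2

theorem MemW.exists_measurable_jet {a : ℕ → ℝ} {m : ℕ} {p : ℝ} {f : Ell2 → ℝ} (hf : MemW a m p f) :
    ∃ g : List ℕ → Ell2 → ℝ, (∀ I, Measurable (g I)) ∧ g [] =ᵐ[P a] f ∧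
      ∀ I : List ℕ, I.length ≤ m → HasWeakDeriv a p I f (g I) := by
  have hmk : ∀ {I : List ℕ} {h : Ell2 → ℝ}, HasWeakDeriv a p I f h →
      ∃ g, Measurable g ∧ g =ᵐ[P a] h ∧ HasWeakDeriv a p I f g := fun {I h} hh =>
    ⟨hh.1.1.mk h, hh.1.1.stronglyMeasurable_mk.measurable, hh.1.1.ae_eq_mk.symm,
      hh.congr (ae_eq_refl f) hh.1.1.ae_eq_mk⟩
  have h : ∀ I : List ℕ, ∃ g : Ell2 → ℝ, Measurable g ∧ (I = [] → g =ᵐ[P a] f) ∧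
      (I.length ≤ m → HasWeakDeriv a p I f g) := fun I => by
    by_cases hI : I.length ≤ m
    · rcases eq_or_ne I [] with rfl | hne
      · obtain ⟨g, h1, h2, h3⟩ := hmk (HasWeakDeriv.nil hf.memLp)
        exact ⟨g, h1, fun _ => h2, fun _ => h3⟩
      · obtain ⟨g, hg⟩ := hf.exists_weakDeriv I.length
          (Finset.mem_Icc.2 ⟨List.length_pos_iff.2 hne, hI⟩) I.get
        rw [List.ofFn_get] at hg
        obtain ⟨g', h1, -, h3⟩ := hmk hg
        exact ⟨g', h1, fun h => absurd h hne, fun _ => h3⟩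
    · refine ⟨fun _ => 0, measurable_const, ?_, fun h => absurd h hI⟩
      rintro rfl
      simp at hI
  choose g h1 h2 h3 using h
  exact ⟨g, h1, h2 [] rfl, h3⟩

theorem MemW.exists_tendsto_normW {a : ℕ → ℝ} (ha : ∀ i, 0 < a i) (hs : Summable a)
    (h1 : ∑' i, a i < 1) {m : ℕ} {p : ℝ} (hp : 1 ≤ p) {f : Ell2 → ℝ} (hf : MemW a m p f) :
    ∃ φ : ℕ → Ell2 → ℝ, (∀ n, IsCylinder (φ n)) ∧
      Tendsto (fun n => normW a m p fun x => φ n x - f x) atTop (𝓝 0) := by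
  have hP := isProbabilityMeasure_P a ha hs h1
  have hp0 : 0 < p := by linarith
  obtain ⟨g, hgm, hg0, hg⟩ := hf.exists_measurable_jet
  have hfin : ∀ k ∈ Finset.range (m + 1), jetEnergy a p k g < ∞ := by
    rw [← ENNReal.sum_lt_top, ← lintegral_add_derivEnergy ha hs h1 hp hg hg0]
    refine ENNReal.add_lt_top.2 ⟨?_, hf.energy_lt_top⟩
    rw [lintegral_enorm_rpow_eq hp]
    exact ENNReal.rpow_lt_top_of_nonneg hp0.le hf.memLp.2.ne
  -- The shift to `n + 1` variables ensures that a cylinder function depends on at least one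
  -- variable.
  have happ := fun n : ℕ => exists_smooth_approx_jet ha hp
    (isJet_avgJet ha hs h1 hp hgm hg (n + 1)) (measurable_avgJet hP hgm (n + 1))
    (fun I hI => memLp_avgJet hP hp (hgm I) (hg I hI).1 (n + 1))
    (fun I hI => by rw [avgJet, if_neg hI])
    (ε := ENNReal.ofReal (1 / ((n : ℝ) + 1))) (by simp; positivity)
  choose u hu hc hε using happ
  refine ⟨fun n x => u n (proj (n + 1) x), fun n => ⟨n + 1, u n, by omega, hu n, hc n, fun x => rfl⟩, ?_⟩
  set S : ℝ≥0∞ := ∑' i, ENNReal.ofReal (a i ^ p) with hS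
  have hSt : S < ∞ := tsum_ofReal_rpow_lt_top ha hs h1 hp
  set A : ℕ → ℕ → ℝ≥0∞ := fun n k =>
    jetEnergy a p k fun I x => avgJet a (n + 1) g I (proj (n + 1) x) - g I x with hA
  set B : ℕ → ℝ≥0∞ := fun n => ∑ k ∈ Finset.range (m + 1), 2 ^ (p - 1) *
    (ENNReal.ofReal (1 / ((n : ℝ) + 1)) ^ p * S ^ k + A n k) with hB
  have hle : ∀ n, normW a m p (fun x => u n (proj (n + 1) x) - f x) ≤ B n ^ (1 / p) := fun n => by
    have hub := bSmooth_comp_proj (hu n) (hc n)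
    have hweak : ∀ I : List ℕ, I.length ≤ m → HasWeakDeriv a p I
        (fun x => u n (proj (n + 1) x) - f x)
        (fun x => dirDs (n + 1) I (u n) (proj (n + 1) x) - g I x) := fun I hI => by
      have h2 := hub.hasWeakDeriv ha hP p I
      rw [pds_comp_proj (hu n)] at h2
      exact h2.sub hP hp (MemLp_integrable_of_one_le hP hp (hub.memLp hP _))
        (MemLp_integrable_of_one_le hP hp hf.memLp) (hg I hI)
    have hbase : (fun x => dirDs (n + 1) [] (u n) (proj (n + 1) x) - g [] x)
        =ᵐ[P a] fun x => u n (proj (n + 1) x) - f x := by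
      filter_upwards [hg0] with x hx
      rw [hx]
      rfl
    refine ENNReal.rpow_le_rpow ?_ (by positivity)
    rw [lintegral_add_derivEnergy ha hs h1 hp
      (h := fun I x => dirDs (n + 1) I (u n) (proj (n + 1) x) - g I x) hweak hbase]
    exact Finset.sum_le_sum fun k hk => jetEnergy_le hP hp hgm (hu n) (hε n)
      (Nat.lt_succ_iff.1 (Finset.mem_range.1 hk))
  have hεlim : Tendsto (fun n : ℕ => ENNReal.ofReal (1 / ((n : ℝ) + 1)) ^ p) atTop (𝓝 0) := by
    have := (ENNReal.tendsto_ofReal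
      (tendsto_one_div_add_atTop_nhds_zero_nat (𝕜 := ℝ))).ennrpow_const p
    simpa [hp0] using this
  have hBlim : Tendsto B atTop (𝓝 0) := by
    have hk : ∀ k ∈ Finset.range (m + 1), Tendsto (fun n : ℕ => (2 : ℝ≥0∞) ^ (p - 1) *
        (ENNReal.ofReal (1 / ((n : ℝ) + 1)) ^ p * S ^ k + A n k)) atTop (𝓝 0) := fun k hk => by
      have hkm : k ≤ m := Nat.lt_succ_iff.1 (Finset.mem_range.1 hk)
      have h2 := (tendsto_jetEnergy_avgJet_sub hP hp hgm
        (fun I hI => (hg I (hI.le.trans hkm)).1) (hfin k hk)).comp (tendsto_add_atTop_nat 1)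
      have h3 := ENNReal.Tendsto.mul_const (b := S ^ k) hεlim (Or.inr (ENNReal.pow_ne_top hSt.ne))
      have h4 := ENNReal.Tendsto.const_mul (a := (2 : ℝ≥0∞) ^ (p - 1)) (h3.add h2)
        (Or.inr (ENNReal.rpow_ne_top_of_nonneg (by linarith) (by simp)))
      simpa using! h4
    have h := tendsto_finsetSum _ hk
    rwa [Finset.sum_const_zero] at h
  have hlim := hBlim.ennrpow_const (1 / p)
  rw [ENNReal.zero_rpow_of_pos (by positivity)] at hlim
  exact tendsto_of_tendsto_of_tendsto_of_le_of_le tendsto_const_nhds hlim (fun _ => zero_le) hle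

end GaussSobolev

end

theorem mainTheorem4 (a : ℕ → ℝ) (ha_pos : ∀ i, 0 < a i) (ha_summable : Summable a)
    (ha_sum : ∑' i, a i < 1) (m : ℕ) (hm : 1 ≤ m) (p : ℝ) (hp : 1 ≤ p) :
    (∀ φ : GaussSobolev.Ell2 → ℝ, GaussSobolev.IsCylinder φ → GaussSobolev.MemW a m p φ) ∧
    ∀ f : GaussSobolev.Ell2 → ℝ, GaussSobolev.MemW a m p f →
      ∃ φ : ℕ → GaussSobolev.Ell2 → ℝ,
        (∀ n, GaussSobolev.IsCylinder (φ n)) ∧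
        Tendsto (fun n => GaussSobolev.normW a m p (fun x => φ n x - f x)) atTop (𝓝 0) :=
  ⟨fun _ hφ => hφ.bSmooth.memW ha_pos ha_summable ha_sum m hp,
    fun _ hf => hf.exists_tendsto_normW ha_pos ha_summable ha_sum hp⟩
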